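/- Let $\mathfrak o$ be the lattice of integral octonions (Coxeter's order, spanned by $e_0,\ e_1,\ e_2,\ -e_4,\ \tfrac12(e_1+e_2+e_3+e_4),\ \tfrac12(-e_0-e_1-e_4+e_5),\ \tfrac12(-e_0+e_1-e_2+e_6),\ \tfrac12(-e_0+e_2+e_4+e_7)$, where $e_ie_{i+1}=e_{i+3}$ with indices modulo $7$). Let $\mathfrak J(\mathbb R)$ be the exceptional Jordan algebra of Hermitian octonionic $3\times 3$ matrices, with determinant $\det$ and trace form $(X,Y)=\mathrm{Tr}(\tfrac12(XY+YX))$, and let $\mathfrak J(\mathbb Z)\subset\mathfrak J(\mathbb R)$ be the lattice of matrices with diagonal entries in $\mathbb Z$ and off-diagonal entries in $\mathfrak o$. Let $R_3^+(\mathbb R)=\{X^2 : X\in\mathfrak J(\mathbb R),\ \det X\ne 0\}$ be the positive cone, $\mathfrak J(\mathbb Z)_{>0}=\mathfrak J(\mathbb Z)\cap R_3^+(\mathbb R)$ and $\mathfrak J(\mathbb Z)_{\ge 0}=\mathfrak J(\mathbb Z)\cap\overline{R_3^+(\mathbb R)}$. For $T\in\mathfrak J(\mathbb Z)$ let $T_1$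 be the half-integral symmetric real matrix obtained from $T$ by replacing each entry by its real part. Let $\mathfrak T=\{X+iY : X\in\mathfrak J(\mathbb R),\ Y\in R_3^+(\mathbb R)\}$ be the exceptional domain. A modular form of weight $k$ and level one on $\mathfrak T$ is a holomorphic function $F$ on $\mathfrak T$ with $F(\gamma Z)=j(\gamma,Z)^kF(Z)$ for all $\gamma\in E_{7,3}(\mathbb Z)$, where $j$ is the canonical factor of automorphy; $A_F(T)$ denotes its Fourier coefficients, $F(Z)=\sum_{T\in\mathfrak J(\mathbb Z)_{\ge 0}}A_F(T)e^{2\pi i(T,Z)}$. It is a cusp form if $\lim_{\mathrm{Im}\,\tau\to\infty}F\begin{pmatrix}Z'&0\\0&\tau\end{pmatrix}=0$ for every Hermitian octonionic $2\times 2$ matrix $Z'$ over $\mathbb C$ whose imaginary part is the square of a real matrix of nonzero determinant. Restricting $F$ to the Siegel upper half space $\mathbb H_3\subset\mathfrak T$ gives a function $F|_{Sp_6}$ with Fourier expansion $$F|_{Sp_6}(Z_1)=\sum_{S}A_{F|_{Sp_6}}(S)\,e^{2\pi i\,\mathrm{Tr}(SZ_1)},\qquad A_{F|_{Sp_6}}(S)=\sum_{T\in\mathfrak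 J(\mathbb Z)_{\ge 0},\ T_1=S}A_F(T),$$ where $S$ runs over the positive semidefinite half-integral symmetric $3\times3$ matrices (integral diagonal, off-diagonal entries in $\tfrac12\mathbb Z$). **Lemma.** Let $$S=\begin{pmatrix}1&\frac12&a\\ \frac12&1&b\\ a&b&c\end{pmatrix}$$ be positive semidefinite and half-integral. Then there is no $T\in\mathfrak J(\mathbb Z)_{>0}$ with $T_1=S$; the set of $T\in\mathfrak J(\mathbb Z)_{\ge 0}$ with $T_1=S$ is finite; and for every cusp form $F$ of level one and any weight $k \in \mathbb Z$ on $\mathfrak T$, $A_{F|_{Sp_6}}(S)=0$, that is, both the sum $\sum_{T\in\mathfrak J(\mathbb Z)_{\ge 0},\,T_1=S}A_F(T)$ and the Fourier coefficient of the function $F|_{Sp_6}$ at $S$ are equal to $0$. -/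

import Mathlib

noncomputable section

namespace ExcDomain

/-! ### Octonions -/

/-- The octonions `∑ xᵢ eᵢ` (`0 ≤ i ≤ 7`) with coordinates in `R`. -/
abbrev Oct (R : Type*) := Fin 8 → R

namespace Oct

variable {R : Type*} [CommRing R]

/-- Octonion multiplication: `e₀ = 1`, `eᵢ² = -1`, and `eᵢ eᵢ₊₁ = eᵢ₊₃ = -eᵢ₊₁ eᵢ` together with its
cyclic rotations, the indices `1, …, 7` being read modulo `7`. -/
def mul (x y : Oct R) : Oct R :=
  ![x 0 * y 0 - x 1 * y 1 - x 2 * y 2 - x 3 * y 3 - x 4 * y 4 - x 5 * y 5 - x 6 * y 6 - x 7 * y 7,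
    x 0 * y 1 + x 1 * y 0 + x 2 * y 4 + x 3 * y 7 - x 4 * y 2 + x 5 * y 6 - x 6 * y 5 - x 7 * y 3,
    x 0 * y 2 - x 1 * y 4 + x 2 * y 0 + x 3 * y 5 + x 4 * y 1 - x 5 * y 3 + x 6 * y 7 - x 7 * y 6,
    x 0 * y 3 - x 1 * y 7 - x 2 * y 5 + x 3 * y 0 + x 4 * y 6 + x 5 * y 2 - x 6 * y 4 + x 7 * y 1,
    x 0 * y 4 + x 1 * y 2 - x 2 * y 1 - x 3 * y 6 + x 4 * y 0 + x 5 * y 7 + x 6 * y 3 - x 7 * y 5,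
    x 0 * y 5 - x 1 * y 6 + x 2 * y 3 - x 3 * y 2 - x 4 * y 7 + x 5 * y 0 + x 6 * y 1 + x 7 * y 4,
    x 0 * y 6 + x 1 * y 5 - x 2 * y 7 + x 3 * y 4 - x 4 * y 3 - x 5 * y 1 + x 6 * y 0 + x 7 * y 2,
    x 0 * y 7 + x 1 * y 3 + x 2 * y 6 - x 3 * y 1 + x 4 * y 5 - x 5 * y 4 - x 6 * y 2 + x 7 * y 0]

/-- Octonion conjugation. -/
def conj (x : Oct R) : Oct R := fun i => if i = 0 then x 0 else -x i

/-- The norm `N(x) = ∑ xᵢ²`. -/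
def N (x : Oct R) : R := ∑ i, x i ^ 2

/-- The trace `Tr(x) = 2 x₀`. -/
def tr (x : Oct R) : R := 2 * x 0

/-- The scalar `r e₀`. -/
def scalar (r : R) : Oct R := fun i => if i = 0 then r else 0

/-- The basis `α₀, …, α₇` of the integral octonions. -/
def basis (K : Type*) [Field K] : Fin 8 → Oct K :=
  ![![1, 0, 0, 0, 0, 0, 0, 0],
    ![0, 1, 0, 0, 0, 0, 0, 0],
    ![0, 0, 1, 0, 0, 0, 0, 0],
    ![0, 0, 0, 0, -1, 0, 0, 0],
    ![0, 1 / 2, 1 / 2, 1 / 2, 1 / 2, 0, 0, 0],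
    ![-1 / 2, -1 / 2, 0, 0, -1 / 2, 1 / 2, 0, 0],
    ![-1 / 2, 1 / 2, -1 / 2, 0, 0, 0, 1 / 2, 0],
    ![-1 / 2, 0, 1 / 2, 0, 1 / 2, 0, 0, 1 / 2]]

/-- The lattice `𝔬` of integral octonions (inside the octonions over a field `K`). -/
def integral (K : Type*) [Field K] : Submodule ℤ (Oct K) := Submodule.span ℤ (Set.range (basis K))

end Oct

/-! ### The exceptional Jordan algebra -/

/-- The exceptional Jordan algebra: `(a, b, c, x, y, z)` stands for the Hermitian octonionic matrix
with rows `(a, x, y)`, `(x̄, b, z)`, `(ȳ, z̄, c)`. Only the additive and scalar structure of the product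
type is used. -/
abbrev J (R : Type*) := R × R × R × Oct R × Oct R × Oct R

namespace J

section Accessors
variable {R : Type*}

/-- The `(1,1)` entry. -/
def a (X : J R) : R := X.1
/-- The `(2,2)` entry. -/
def b (X : J R) : R := X.2.1
/-- The `(3,3)` entry. -/
def c (X : J R) : R := X.2.2.1
/-- The `(1,2)` entry. -/
def x (X : J R) : Oct R := X.2.2.2.1
/-- The `(1,3)` entry. -/
def y (X : J R) : Oct R := X.2.2.2.2.1
/-- The `(2,3)` entry. -/
def z (X : J R) : Oct R := X.2.2.2.2.2

end Accessors

open Oct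

variable {R : Type*} [CommRing R]

/-- The identity matrix. -/
def one (R : Type*) [CommRing R] : J R := (1, 1, 1, 0, 0, 0)

/-- The square `X · X = X ∘ X` (matrix multiplication). -/
def sq (X : J R) : J R :=
  (X.a ^ 2 + N X.x + N X.y, X.b ^ 2 + N X.x + N X.z, X.c ^ 2 + N X.y + N X.z,
    (X.a + X.b) • X.x + Oct.mul X.y (conj X.z),
    (X.a + X.c) • X.y + Oct.mul X.x X.z,
    (X.b + X.c) • X.z + Oct.mul (conj X.x) X.y)

/-- The product `X × X`. -/
def sharp (X : J R) : J R :=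
  (X.b * X.c - N X.z, X.a * X.c - N X.y, X.a * X.b - N X.x,
    Oct.mul X.y (conj X.z) - X.c • X.x,
    Oct.mul X.x X.z - X.b • X.y,
    Oct.mul (conj X.x) X.y - X.a • X.z)

/-- The determinant `abc - a N(z) - b N(y) - c N(x) + Tr((xz)ȳ)`. -/
def det (X : J R) : R :=
  X.a * X.b * X.c - X.a * N X.z - X.b * N X.y - X.c * N X.x
    + tr (Oct.mul (Oct.mul X.x X.z) (conj X.y))

/-- The trace form `(X, Y) = Tr(X ∘ Y)`, where `X ∘ Y = (X · Y + Y · X) / 2`. -/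
def pairing (X Y : J R) : R :=
  X.a * Y.a + X.b * Y.b + X.c * Y.c
    + tr (Oct.mul X.x (conj Y.x)) + tr (Oct.mul X.y (conj Y.y)) + tr (Oct.mul X.z (conj Y.z))

/-- The lattice `𝔍(ℤ)`: diagonal entries in `ℤ`, off-diagonal entries in `𝔬`. -/
def integral (K : Type*) [Field K] : Set (J K) :=
  {X | (∃ n : ℤ, X.a = n) ∧ (∃ n : ℤ, X.b = n) ∧ (∃ n : ℤ, X.c = n) ∧
    X.x ∈ Oct.integral K ∧ X.y ∈ Oct.integral K ∧ X.z ∈ Oct.integral K}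

/-- The positive cone `R₃⁺(ℝ)`: squares of the elements of nonzero determinant. -/
def posCone : Set (J ℝ) := {T | ∃ X : J ℝ, X.det ≠ 0 ∧ T = X.sq}

/-- `𝔍(ℤ)_{>0}`. -/
def integralPos : Set (J ℝ) := integral ℝ ∩ posCone

/-- `𝔍(ℤ)_{≥0}`. -/
def integralNonneg : Set (J ℝ) := integral ℝ ∩ closure posCone

/-- `T₁`: the real symmetric matrix left when the imaginary octonion part of `T` is dropped. -/
def symPart (T : J ℝ) : Matrix (Fin 3) (Fin 3) ℝ :=
  !![T.a, T.x 0, T.y 0; T.x 0, T.b, T.z 0; T.y 0, T.z 0, T.c]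

/-- The element `X + i Y` of the complexified algebra. -/
def toComplex (X Y : J ℝ) : J ℂ :=
  (X.a + Y.a * Complex.I, X.b + Y.b * Complex.I, X.c + Y.c * Complex.I,
    fun i => X.x i + Y.x i * Complex.I, fun i => X.y i + Y.y i * Complex.I,
    fun i => X.z i + Y.z i * Complex.I)

/-- The coordinatewise imaginary part of an element of the complexified algebra. -/
def im (Z : J ℂ) : J ℝ :=
  (Z.a.im, Z.b.im, Z.c.im, fun i => (Z.x i).im, fun i => (Z.y i).im, fun i => (Z.z i).im)

end J

/-- The exceptional domain `𝔗 = {X + iY : Y ∈ R₃⁺(ℝ)}`. -/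
def domain : Set (J ℂ) := {Z | Z.im ∈ J.posCone}

/-! ### The group `E_{7,3}(ℤ)` and its automorphy factor -/

/-- The 56-dimensional space of quadruples `(X, ξ, X', ξ')`. -/
abbrev W := J ℂ × ℂ × J ℂ × ℂ

/-- The quartic form
`(X × X, X' × X') - ξ det X - ξ' det X' - ((X, X') - ξ ξ')² / 4`. -/
def quartic (w : W) : ℂ :=
  J.pairing w.1.sharp w.2.2.1.sharp - w.2.1 * w.1.det - w.2.2.2 * w.2.2.1.det
    - (J.pairing w.1 w.2.2.1 - w.2.1 * w.2.2.2) ^ 2 / 4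

/-- The alternating form `(X₁, X₂') - (X₂, X₁') + ξ₁ ξ₂' - ξ₂ ξ₁'`. -/
def symp (w v : W) : ℂ :=
  J.pairing w.1 v.2.2.1 - J.pairing v.1 w.2.2.1 + w.2.1 * v.2.2.2 - v.2.1 * w.2.2.2

/-- The lattice `𝔍(ℤ) ⊕ ℤ ⊕ 𝔍(ℤ) ⊕ ℤ`. -/
def latticeW : Set W :=
  {w | w.1 ∈ J.integral ℂ ∧ (∃ n : ℤ, w.2.1 = n) ∧ w.2.2.1 ∈ J.integral ℂ ∧ ∃ n : ℤ, w.2.2.2 = n}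

/-- `E_{7,3}(ℤ)`: the linear automorphisms of the 56-dimensional space which preserve the quartic form,
the alternating form and the lattice. (The lattice spans, so such maps are automatically defined over
`ℚ`.) -/
def Gamma : Subgroup (W ≃ₗ[ℂ] W) where
  carrier := {g | (∀ w, quartic (g w) = quartic w) ∧ (∀ w v, symp (g w) (g v) = symp w v) ∧
    ∀ w, g w ∈ latticeW ↔ w ∈ latticeW}
  mul_mem' := by
    rintro g h ⟨hg1, hg2, hg3⟩ ⟨hh1, hh2, hh3⟩
    exact ⟨fun w => (hg1 _).trans (hh1 w), fun w v => (hg2 _ _).trans (hh2 w v),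
      fun w => (hg3 _).trans (hh3 w)⟩
  one_mem' := ⟨fun _ => rfl, fun _ _ => rfl, fun _ => Iff.rfl⟩
  inv_mem' := by
    rintro g ⟨hg1, hg2, hg3⟩
    have key : ∀ w, g (g⁻¹ w) = w := fun w => g.apply_symm_apply w
    refine ⟨fun w => ?_, fun w v => ?_, fun w => ?_⟩
    · rw [← hg1, key]
    · rw [← hg2, key, key]
    · rw [← hg3, key]

/-- The vector `(Z, det Z, Z × Z, 1)`. The action of the group on the exceptional domain and the
canonical automorphy factor `j` are given by `g · toW Z = j(g, Z) • toW (g Z)`. -/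
def toW (Z : J ℂ) : W := (Z, Z.det, Z.sharp, 1)

/-! ### Modular forms and cusp forms -/

/-- Modular forms of weight `k` and level one on the exceptional domain: holomorphic functions with
`F(g Z) = j(g, Z)ᵏ F(Z)` for `g ∈ E_{7,3}(ℤ)`; here `Z'` is `g Z` and `j` is `j(g, Z)`. -/
structure IsModularForm (k : ℤ) (F : J ℂ → ℂ) : Prop where
  holo : DifferentiableOn ℂ F domain
  transform : ∀ g ∈ Gamma, ∀ Z ∈ domain, ∀ Z' ∈ domain, ∀ j : ℂ,
    g (toW Z) = j • toW Z' → F Z' = j ^ k * F Z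

/-- The Hermitian octonionic `2 × 2` matrices: `(a, b, x)` has rows `(a, x)`, `(x̄, b)`. -/
abbrev J2 (R : Type*) := R × R × Oct R

/-- The positive cone of `2 × 2` matrices: squares of the matrices of nonzero determinant
`ab - N(x)`. -/
def posCone2 : Set (J2 ℝ) :=
  {T | ∃ (a b : ℝ) (x : Oct ℝ), a * b - Oct.N x ≠ 0 ∧
    T = (a ^ 2 + Oct.N x, b ^ 2 + Oct.N x, (a + b) • x)}

/-- The domain `𝔗₂` of `2 × 2` matrices with imaginary part in the positive cone. -/
def domain2 : Set (J2 ℂ) := {Z | (Z.1.im, Z.2.1.im, fun i => (Z.2.2 i).im) ∈ posCone2}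

/-- The block diagonal matrix with blocks `Z` and `τ`. -/
def block (Z : J2 ℂ) (τ : ℂ) : J ℂ := (Z.1, Z.2.1, τ, Z.2.2, 0, 0)

/-- Cusp forms of weight `k` and level one: modular forms with `Φ(F) = 0`, where
`Φ(F)(Z) = lim F(diag(Z, τ))` as `Im τ → ∞`. -/
structure IsCuspForm (k : ℤ) (F : J ℂ → ℂ) : Prop extends IsModularForm k F where
  cusp : ∀ Z ∈ domain2, Filter.Tendsto (fun τ : ℂ => F (block Z τ))
    (Filter.comap Complex.im Filter.atTop) (nhds 0)

/-! ### Fourier coefficients -/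

/-- The coordinates of `𝔍(ℝ) ≅ ℝ²⁷` with respect to the `ℤ`-basis of `𝔍(ℤ)` that consists of the three
diagonal units and of `α₀, …, α₇` in each of the three off-diagonal places. -/
def ofCoords (t : Fin 3 ⊕ Fin 3 × Fin 8 → ℝ) : J ℝ :=
  (t (Sum.inl 0), t (Sum.inl 1), t (Sum.inl 2),
    ∑ i, t (Sum.inr (0, i)) • Oct.basis ℝ i,
    ∑ i, t (Sum.inr (1, i)) • Oct.basis ℝ i,
    ∑ i, t (Sum.inr (2, i)) • Oct.basis ℝ i)

/-- The Fourier coefficient `A_F(T)` in `F(Z) = ∑ A_F(T) e^{2πi (T, Z)}`: the integral of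
`F(Z) e^{-2πi (T, Z)}`, `Z = X + i`, over `X ∈ 𝔍(ℝ) / 𝔍(ℤ)` (of total volume one; for a modular form the
base point `i` may be replaced by `iY` with any `Y` in the positive cone). -/
def fourierCoeff (F : J ℂ → ℂ) (T : J ℝ) : ℂ :=
  ∫ t in Set.Icc (0 : Fin 3 ⊕ Fin 3 × Fin 8 → ℝ) 1,
    F (J.toComplex (ofCoords t) (J.one ℝ)) *
      Complex.exp (-(2 * Real.pi * Complex.I *
        J.pairing (J.toComplex T 0) (J.toComplex (ofCoords t) (J.one ℝ))))

/-- `∑ A_F(T)` over the `T ∈ 𝔍(ℤ)_{≥0}` with `T₁ = S`. -/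
def restrictedCoeff (F : J ℂ → ℂ) (S : Matrix (Fin 3) (Fin 3) ℝ) : ℂ :=
  ∑ᶠ T ∈ {T : J ℝ | T ∈ J.integralNonneg ∧ T.symPart = S}, fourierCoeff F T

/-! ### Restriction to the Siegel upper half space -/

/-- The embedding of the Siegel upper half space of degree three (symmetric matrices `Z` with positive
definite imaginary part) into the exceptional domain. -/
def siegelEmbed (Z : Matrix (Fin 3) (Fin 3) ℂ) : J ℂ :=
  (Z 0 0, Z 1 1, Z 2 2, Oct.scalar (Z 0 1), Oct.scalar (Z 0 2), Oct.scalar (Z 1 2))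

/-- The restriction of `F` to the Siegel upper half space. -/
def restrict (F : J ℂ → ℂ) : Matrix (Fin 3) (Fin 3) ℂ → ℂ := fun Z => F (siegelEmbed Z)

/-- The symmetric matrix with diagonal `t₀, t₁, t₂` and off-diagonal entries `t₃, t₄, t₅` in the places
`(1,2)`, `(1,3)`, `(2,3)`, plus `i` times the identity. -/
def siegelPoint (t : Fin 6 → ℝ) : Matrix (Fin 3) (Fin 3) ℂ :=
  !![(t 0 : ℂ) + Complex.I, (t 3 : ℂ), (t 4 : ℂ);
    (t 3 : ℂ), (t 1 : ℂ) + Complex.I, (t 5 : ℂ);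
    (t 4 : ℂ), (t 5 : ℂ), (t 2 : ℂ) + Complex.I]

/-- The Fourier coefficient at `S` of a function `G(Z) = ∑ A(S) e^{2πi Tr(SZ)}` on the Siegel upper half
space of degree three: the integral of `G(Z) e^{-2πi Tr(SZ)}`, `Z = X + i`, over the real symmetric
matrices `X` modulo the integral ones. -/
def siegelFourierCoeff (G : Matrix (Fin 3) (Fin 3) ℂ → ℂ) (S : Matrix (Fin 3) (Fin 3) ℝ) : ℂ :=
  ∫ t in Set.Icc (0 : Fin 6 → ℝ) 1,
    G (siegelPoint t) *
      Complex.exp (-(2 * Real.pi * Complex.I * (S.map Complex.ofReal * siegelPoint t).trace))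

/-- `Sym³(ℤ)_{≥0}`: the positive semidefinite half-integral symmetric `3 × 3` matrices (integral diagonal,
off-diagonal entries in `ℤ / 2`). -/
def halfIntegralNonneg : Set (Matrix (Fin 3) (Fin 3) ℝ) :=
  {S | S.PosSemidef ∧ (∀ i, ∃ n : ℤ, S i i = n) ∧ ∀ i j, ∃ n : ℤ, S i j = (n : ℝ) / 2}

end ExcDomain

end

/-!
Suppose `T` is integral with first two diagonal entries `1` and real part of `x` equal to `1 / 2`.
Then `x` is a nonzero integral octonion, so `N x ≥ 1` and the leading minor `1 - N x` of `T` is not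
positive: `T` cannot lie in the open cone. Shearing `x` out of `T` by an integral transvection
replaces the second diagonal entry by that minor without changing the Fourier coefficient.

Fourier coefficients are invariant under integral transvections and grow at most exponentially in
the trace. A negative diagonal entry, or a zero one with a nonzero entry in its row, allows shears
along which the trace tends to `-∞`, so the coefficient vanishes, as in the Koecher principle. What
remains is a block-diagonal `T` with a zero corner; its coefficient is a Fourier coefficient of the
limit of `F` at the boundary, which is zero for a cusp form.

The Siegel coefficient at `S` is an integral over a slice of the torus `𝔍(ℝ)/𝔍(ℤ)`. In the
transverse directions `F` is given by a Fourier series in which only the `T` with `T₁ = S` survive,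
and all these coefficients vanish.
-/

noncomputable section

namespace ExcDomain

/-! ### Octonion algebra -/

namespace Oct

variable {R : Type*} [CommRing R]

/-- The bilinear form `Tr(x ȳ)`, the polarization of the norm `N`. -/
def bil (x y : Oct R) : R := tr (mul x (conj y))

/-- The trilinear form `Tr((x z) ȳ)`, with its arguments in the order in which it occurs in the
determinant of the Hermitian matrix with off-diagonal entries `x`, `y`, `z`. -/
def tri (x z y : Oct R) : R := tr (mul (mul x z) (conj y))

lemma ext8 {S : Type*} {x y : Oct S} (h0 : x 0 = y 0) (h1 : x 1 = y 1) (h2 : x 2 = y 2)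
    (h3 : x 3 = y 3) (h4 : x 4 = y 4) (h5 : x 5 = y 5) (h6 : x 6 = y 6) (h7 : x 7 = y 7) :
    x = y := by
  funext i
  fin_cases i <;> assumption

section Bilinear

variable (x y z w : Oct R) (r : R)

lemma conj_eq : conj x = ![x 0, -x 1, -x 2, -x 3, -x 4, -x 5, -x 6, -x 7] := by
  apply ext8 <;> rfl

lemma N_eq : N x = x 0 ^ 2 + x 1 ^ 2 + x 2 ^ 2 + x 3 ^ 2 + x 4 ^ 2 + x 5 ^ 2 + x 6 ^ 2 + x 7 ^ 2 :=
  Fin.sum_univ_eight _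

lemma bil_eq : bil x y = 2 * (x 0 * y 0 + x 1 * y 1 + x 2 * y 2 + x 3 * y 3
    + x 4 * y 4 + x 5 * y 5 + x 6 * y 6 + x 7 * y 7) := by
  simp only [bil, tr, mul, conj_eq, Matrix.cons_val]
  ring

@[simp] lemma conj_conj : conj (conj x) = x := by
  apply ext8 <;> simp [conj_eq]
@[simp] lemma conj_add : conj (x + y) = conj x + conj y := by
  apply ext8 <;> simp [conj_eq, add_comm]
@[simp] lemma conj_smul : conj (r • x) = r • conj x := by
  apply ext8 <;> simp [conj_eq]
@[simp] lemma conj_neg : conj (-x) = -conj x := by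
  simpa using conj_smul x (-1)
@[simp] lemma conj_sub : conj (x - y) = conj x - conj y := by
  simp only [sub_eq_add_neg, conj_add, conj_neg]
@[simp] lemma conj_zero : conj (0 : Oct R) = 0 := by
  simpa using conj_smul (0 : Oct R) 0

protected lemma add_mul : mul (x + y) z = mul x z + mul y z := by
  apply ext8 <;> simp only [mul, Matrix.cons_val, Pi.add_apply] <;> ring
protected lemma mul_add : mul x (y + z) = mul x y + mul x z := by
  apply ext8 <;> simp only [mul, Matrix.cons_val, Pi.add_apply] <;> ring
protected lemma smul_mul : mul (r • x) y = r • mul x y := by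
  apply ext8 <;> simp only [mul, Matrix.cons_val, Pi.smul_apply, smul_eq_mul] <;> ring
protected lemma mul_smul : mul x (r • y) = r • mul x y := by
  apply ext8 <;> simp only [mul, Matrix.cons_val, Pi.smul_apply, smul_eq_mul] <;> ring
@[simp] protected lemma neg_mul : mul (-x) y = -mul x y := by
  simpa using Oct.smul_mul x y (-1)
@[simp] protected lemma mul_neg : mul x (-y) = -mul x y := by
  simpa using Oct.mul_smul x y (-1)
protected lemma sub_mul : mul (x - y) z = mul x z - mul y z := by
  simp only [sub_eq_add_neg, Oct.add_mul, Oct.neg_mul]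
protected lemma mul_sub : mul x (y - z) = mul x y - mul x z := by
  simp only [sub_eq_add_neg, Oct.mul_add, Oct.mul_neg]
@[simp] protected lemma mul_zero : mul x 0 = 0 := by
  simpa using Oct.mul_smul x (0 : Oct R) 0
@[simp] protected lemma zero_mul : mul 0 x = 0 := by
  simpa using Oct.smul_mul (0 : Oct R) x 0

@[simp] protected lemma conj_mul : conj (mul x y) = mul (conj y) (conj x) := by
  apply ext8 <;> simp only [mul, conj_eq, Matrix.cons_val] <;> ring

lemma bil_comm : bil x y = bil y x := by
  simp only [bil_eq]; ring
lemma bil_add_left : bil (x + y) z = bil x z + bil y z := by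
  simp only [bil_eq, Pi.add_apply]; ring
lemma bil_add_right : bil x (y + z) = bil x y + bil x z := by
  rw [bil_comm, bil_add_left, bil_comm y, bil_comm z]
lemma bil_smul_left : bil (r • x) y = r * bil x y := by
  simp only [bil_eq, Pi.smul_apply, smul_eq_mul]; ring
lemma bil_smul_right : bil x (r • y) = r * bil x y := by
  rw [bil_comm, bil_smul_left, bil_comm y]
@[simp] lemma bil_neg_left : bil (-x) y = -bil x y := by
  simpa using bil_smul_left x y (-1)
lemma bil_sub_left : bil (x - y) z = bil x z - bil y z := by
  simp only [sub_eq_add_neg, bil_add_left, bil_neg_left]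
lemma bil_sub_right : bil x (y - z) = bil x y - bil x z := by
  rw [bil_comm, bil_sub_left, bil_comm y, bil_comm z]
@[simp] lemma bil_zero_left : bil 0 x = 0 := by
  simpa using bil_smul_left 0 x 0
@[simp] lemma bil_zero_right : bil x 0 = 0 := by
  rw [bil_comm, bil_zero_left]
@[simp] lemma bil_conj_conj : bil (conj x) (conj y) = bil x y := by
  simp only [bil_eq, conj_eq, Matrix.cons_val, neg_mul_neg]
lemma bil_self : bil x x = 2 * N x := by
  simp only [bil_eq, N_eq]; ring

lemma N_add : N (x + y) = N x + bil x y + N y := by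
  simp only [bil_eq, N_eq, Pi.add_apply]; ring
lemma N_smul : N (r • x) = r ^ 2 * N x := by
  simp only [N_eq, Pi.smul_apply, smul_eq_mul]; ring
@[simp] lemma N_neg : N (-x) = N x := by
  simpa using N_smul x (-1)
lemma N_sub : N (x - y) = N x - bil x y + N y := by
  rw [← neg_sub, N_neg, sub_eq_add_neg, N_add, N_neg, bil_comm, bil_neg_left]; ring
@[simp] lemma N_zero : N (0 : Oct R) = 0 := by
  simpa using N_smul (0 : Oct R) 0
@[simp] lemma N_conj : N (conj x) = N x := by
  simp only [N_eq, conj_eq, Matrix.cons_val, neg_sq]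

lemma bil_mul : bil (mul x z) y = tri x z y := rfl
lemma bil_mul_conj : bil (mul y (conj z)) x = tri x z y := by
  simp only [tri, tr, bil_eq, mul, conj_eq, Matrix.cons_val]
  ring
lemma bil_conj_mul : bil (mul (conj x) y) z = tri x z y := by
  simp only [tri, tr, bil_eq, mul, conj_eq, Matrix.cons_val]
  ring

lemma tri_add_left : tri (x + w) z y = tri x z y + tri w z y := by
  simp only [← bil_mul, Oct.add_mul, bil_add_left]
lemma tri_add_mid : tri x (z + w) y = tri x z y + tri x w y := by
  simp only [← bil_mul, Oct.mul_add, bil_add_left]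
lemma tri_add_right : tri x z (y + w) = tri x z y + tri x z w := by
  simp only [← bil_mul, bil_add_right]
lemma tri_smul_left : tri (r • x) z y = r * tri x z y := by
  simp only [← bil_mul, Oct.smul_mul, bil_smul_left]
lemma tri_smul_mid : tri x (r • z) y = r * tri x z y := by
  simp only [← bil_mul, Oct.mul_smul, bil_smul_left]
lemma tri_smul_right : tri x z (r • y) = r * tri x z y := by
  simp only [← bil_mul, bil_smul_right]
@[simp] lemma tri_zero_right : tri x z 0 = 0 := by
  simp only [← bil_mul, bil_zero_right]
lemma tri_conj_left : tri (conj x) y z = tri x z y := by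
  rw [← bil_mul, bil_conj_mul]
lemma tri_conj_mid : tri y (conj z) x = tri x z y := by
  rw [← bil_mul, bil_mul_conj]

lemma N_mul : N (mul x y) = N x * N y := by
  simp only [N_eq, mul, Matrix.cons_val]
  ring

lemma mul_mul_conj_self : mul (mul x y) (conj y) = N y • x := by
  apply ext8 <;> simp only [N_eq, mul, conj_eq, Matrix.cons_val, Pi.smul_apply,
    smul_eq_mul] <;> ring

lemma conj_self_mul_mul : mul (conj x) (mul x y) = N x • y := by
  apply ext8 <;> simp only [N_eq, mul, conj_eq, Matrix.cons_val, Pi.smul_apply,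
    smul_eq_mul] <;> ring

lemma mul_conj_self_mul : mul (mul x (conj y)) y = N y • x := by
  simpa using mul_mul_conj_self x (conj y)

lemma mul_conj_mul_self : mul x (mul (conj x) y) = N x • y := by
  simpa using conj_self_mul_mul (conj x) y

lemma mul_conj_mul_add : mul x (mul (conj w) y) + mul w (mul (conj x) y) = bil w x • y := by
  have h := mul_conj_mul_self (x + w) y
  rw [conj_add, Oct.add_mul, Oct.add_mul, Oct.mul_add, Oct.mul_add, mul_conj_mul_self,
    mul_conj_mul_self, N_add, bil_comm] at h
  linear_combination (norm := module) h

/-- The middle Moufang identity, with the product `x (z ȳ) x` expanded by the composition law. -/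
lemma moufang : mul (mul x z) (mul (conj y) x) = tri x z y • x - N x • mul y (conj z) := by
  apply ext8 <;> simp only [tri, tr, N_eq, mul, conj_eq, Matrix.cons_val, Pi.smul_apply,
    Pi.sub_apply, smul_eq_mul] <;> ring

end Bilinear

end Oct

/-! ### Algebra of the exceptional Jordan algebra -/

namespace J

open Oct

section Entries

variable {S : Type*}

lemma ext6 {X Y : J S} (ha : X.a = Y.a) (hb : X.b = Y.b) (hc : X.c = Y.c)
    (hx : X.x = Y.x) (hy : X.y = Y.y) (hz : X.z = Y.z) : X = Y :=
  Prod.ext ha (Prod.ext hb (Prod.ext hc (Prod.ext hx (Prod.ext hy hz))))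

variable (p q r : S) (u v w : Oct S)

@[simp] lemma a_mk : J.a (p, q, r, u, v, w) = p := rfl
@[simp] lemma b_mk : J.b (p, q, r, u, v, w) = q := rfl
@[simp] lemma c_mk : J.c (p, q, r, u, v, w) = r := rfl
@[simp] lemma x_mk : J.x (p, q, r, u, v, w) = u := rfl
@[simp] lemma y_mk : J.y (p, q, r, u, v, w) = v := rfl
@[simp] lemma z_mk : J.z (p, q, r, u, v, w) = w := rfl

end Entries

variable {R : Type*} [CommRing R]

section Entries

variable (X Y : J R) (r : R)

@[simp] lemma a_add : (X + Y).a = X.a + Y.a := rfl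
@[simp] lemma b_add : (X + Y).b = X.b + Y.b := rfl
@[simp] lemma c_add : (X + Y).c = X.c + Y.c := rfl
@[simp] lemma x_add : (X + Y).x = X.x + Y.x := rfl
@[simp] lemma y_add : (X + Y).y = X.y + Y.y := rfl
@[simp] lemma z_add : (X + Y).z = X.z + Y.z := rfl
@[simp] lemma a_smul : (r • X).a = r * X.a := rfl
@[simp] lemma b_smul : (r • X).b = r * X.b := rfl
@[simp] lemma c_smul : (r • X).c = r * X.c := rfl
@[simp] lemma x_smul : (r • X).x = r • X.x := rfl
@[simp] lemma y_smul : (r • X).y = r • X.y := rfl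
@[simp] lemma z_smul : (r • X).z = r • X.z := rfl
@[simp] lemma a_zero : (0 : J R).a = 0 := rfl
@[simp] lemma b_zero : (0 : J R).b = 0 := rfl
@[simp] lemma c_zero : (0 : J R).c = 0 := rfl
@[simp] lemma x_zero : (0 : J R).x = 0 := rfl
@[simp] lemma y_zero : (0 : J R).y = 0 := rfl
@[simp] lemma z_zero : (0 : J R).z = 0 := rfl

end Entries

/-- The symmetric bilinear map `X × Y + Y × X`, the linearization of the product `X × X`. -/
def cross (X Y : J R) : J R :=
  (X.b * Y.c + Y.b * X.c - bil X.z Y.z, X.a * Y.c + Y.a * X.c - bil X.y Y.y,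
    X.a * Y.b + Y.a * X.b - bil X.x Y.x,
    mul X.y (conj Y.z) + mul Y.y (conj X.z) - X.c • Y.x - Y.c • X.x,
    mul X.x Y.z + mul Y.x X.z - X.b • Y.y - Y.b • X.y,
    mul (conj X.x) Y.y + mul (conj Y.x) X.y - X.a • Y.z - Y.a • X.z)

variable (X Y Z : J R) (r : R)

lemma pairing_eq : pairing X Y = X.a * Y.a + X.b * Y.b + X.c * Y.c
    + bil X.x Y.x + bil X.y Y.y + bil X.z Y.z := rfl

lemma det_eq : det X = X.a * X.b * X.c - X.a * N X.z - X.b * N X.y - X.c * N X.x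
    + tri X.x X.z X.y := rfl

lemma pairing_comm : pairing X Y = pairing Y X := by
  simp only [pairing_eq, bil_comm X.x, bil_comm X.y, bil_comm X.z]; ring
lemma pairing_add_left : pairing (X + Y) Z = pairing X Z + pairing Y Z := by
  simp only [pairing_eq, a_add, b_add, c_add, x_add, y_add, z_add, bil_add_left]; ring
lemma pairing_smul_left : pairing (r • X) Y = r * pairing X Y := by
  simp only [pairing_eq, a_smul, b_smul, c_smul, x_smul, y_smul, z_smul, bil_smul_left]; ring
lemma pairing_add_right : pairing X (Y + Z) = pairing X Y + pairing X Z := by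
  rw [pairing_comm, pairing_add_left, pairing_comm Y, pairing_comm Z]
lemma pairing_smul_right : pairing X (r • Y) = r * pairing X Y := by
  rw [pairing_comm, pairing_smul_left, pairing_comm Y]
@[simp] lemma pairing_neg_right : pairing X (-Y) = -pairing X Y := by
  simpa using pairing_smul_right X Y (-1)

lemma sharp_add : sharp (X + Y) = sharp X + cross X Y + sharp Y := by
  apply ext6 <;> simp only [sharp, cross, a_add, b_add, c_add, x_add, y_add, z_add, a_mk, b_mk,
    c_mk, x_mk, y_mk, z_mk, N_add, conj_add, Oct.add_mul, Oct.mul_add]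
  · ring
  · ring
  · ring
  all_goals module

lemma sharp_smul : sharp (r • X) = r ^ 2 • sharp X := by
  apply ext6 <;> simp only [sharp, a_smul, b_smul, c_smul, x_smul, y_smul, z_smul, a_mk, b_mk,
    c_mk, x_mk, y_mk, z_mk, N_smul, conj_smul, Oct.smul_mul, Oct.mul_smul]
  · ring
  · ring
  · ring
  all_goals module

@[simp] lemma sharp_neg : sharp (-X) = sharp X := by
  simpa using sharp_smul X (-1)

lemma cross_comm : cross X Y = cross Y X := by
  apply ext6 <;> simp only [cross, a_mk, b_mk, c_mk, x_mk, y_mk, z_mk, bil_comm X.x,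
    bil_comm X.y, bil_comm X.z]
  · ring
  · ring
  · ring
  all_goals module

lemma cross_add_left : cross (X + Y) Z = cross X Z + cross Y Z := by
  apply ext6 <;> simp only [cross, a_add, b_add, c_add, x_add, y_add, z_add, a_mk, b_mk,
    c_mk, x_mk, y_mk, z_mk, bil_add_left, conj_add, Oct.add_mul, Oct.mul_add]
  · ring
  · ring
  · ring
  all_goals module

lemma cross_smul_left : cross (r • X) Y = r • cross X Y := by
  apply ext6 <;> simp only [cross, a_smul, b_smul, c_smul, x_smul, y_smul, z_smul, a_mk, b_mk,
    c_mk, x_mk, y_mk, z_mk, bil_smul_left, conj_smul, Oct.smul_mul, Oct.mul_smul]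
  · ring
  · ring
  · ring
  all_goals module

lemma cross_smul_right : cross X (r • Y) = r • cross X Y := by
  rw [cross_comm, cross_smul_left, cross_comm]

@[simp] lemma cross_neg_right : cross X (-Y) = -cross X Y := by
  simpa using cross_smul_right X Y (-1)

lemma cross_self : cross X X = (2 : R) • sharp X := by
  apply ext6 <;> simp only [cross, sharp, a_smul, b_smul, c_smul, x_smul, y_smul, z_smul, a_mk,
    b_mk, c_mk, x_mk, y_mk, z_mk, bil_self]
  · ring
  · ring
  · ring
  all_goals module

lemma pairing_cross_rotate : pairing (cross X Y) Z = pairing X (cross Y Z) := by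
  simp only [pairing_eq, cross, a_mk, b_mk, c_mk, x_mk, y_mk, z_mk, bil_add_left, bil_sub_left,
    bil_smul_left, bil_add_right, bil_sub_right, bil_smul_right, bil_mul, tri_conj_left,
    tri_conj_mid, bil_comm _ (mul _ _)]
  ring

lemma pairing_cross_self : pairing (cross X Y) Y = 2 * pairing X (sharp Y) := by
  rw [pairing_cross_rotate, cross_self, pairing_smul_right]

lemma pairing_cross_left_self : pairing X (cross X Y) = 2 * pairing (sharp X) Y := by
  rw [← pairing_cross_rotate, cross_self, pairing_smul_left]

lemma det_add : det (X + Y) = det X + pairing (sharp X) Y + pairing X (sharp Y) + det Y := by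
  simp only [det_eq, pairing_eq, sharp, a_mk, b_mk, c_mk, x_mk, y_mk, z_mk, a_add, b_add, c_add,
    x_add, y_add, z_add, N_add, tri_add_left, tri_add_mid, tri_add_right, bil_sub_left,
    bil_smul_left, bil_sub_right, bil_smul_right, bil_mul, tri_conj_left, tri_conj_mid,
    bil_comm _ (mul _ _)]
  ring

lemma det_smul : det (r • X) = r ^ 3 * det X := by
  simp only [det_eq, a_smul, b_smul, c_smul, x_smul, y_smul, z_smul, N_smul, tri_smul_left,
    tri_smul_mid, tri_smul_right]
  ring

@[simp] lemma det_neg : det (-X) = -det X := by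
  rw [← neg_one_smul R X, det_smul]; ring

lemma pairing_sharp_self : pairing (sharp X) X = 3 * det X := by
  simp only [det_eq, pairing_eq, sharp, a_mk, b_mk, c_mk, x_mk, y_mk, z_mk, bil_sub_left,
    bil_smul_left, bil_mul, tri_conj_left, tri_conj_mid, bil_self]
  ring

lemma sharp_sharp : sharp (sharp X) = det X • X := by
  have moufang_x := moufang X.x X.y X.z
  have moufang_y := moufang X.y X.x (conj X.z)
  have moufang_z := moufang X.z (conj X.x) (conj X.y)
  simp only [conj_conj, tri_conj_left, tri_conj_mid] at moufang_x moufang_y moufang_z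
  apply ext6 <;> simp only [sharp, det_eq, a_smul, b_smul, c_smul, x_smul, y_smul, z_smul, a_mk,
    b_mk, c_mk, x_mk, y_mk, z_mk, N_sub, N_mul, N_conj, N_smul, bil_smul_right, bil_mul,
    tri_conj_left, tri_conj_mid, conj_sub, Oct.conj_mul, conj_conj, conj_smul, Oct.sub_mul,
    Oct.mul_sub, Oct.smul_mul, Oct.mul_smul, mul_mul_conj_self, conj_self_mul_mul,
    mul_conj_self_mul, mul_conj_mul_self]
  · ring
  · ring
  · ring
  · rw [moufang_x]; module
  · rw [moufang_y]; module
  · rw [moufang_z]; module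

lemma det_sharp [NoZeroDivisors R] [CharZero R] : det (sharp X) = det X ^ 2 := by
  have h := pairing_sharp_self (sharp X)
  rw [sharp_sharp, pairing_smul_left, pairing_comm, pairing_sharp_self] at h
  have h3 : (3 : R) ≠ 0 := by norm_num
  exact mul_left_cancel₀ h3 (by linear_combination -h)

end J

/-! ### Integral octonions -/

lemma mem_bot_subring {K : Type*} [Ring K] {r : K} :
    r ∈ (⊥ : Subring K) ↔ ∃ n : ℤ, r = n := by
  simp only [Subring.mem_bot, eq_comm]

namespace Oct

/-- The coefficients of an octonion in the basis `α₀, …, α₇` of the integral octonions. -/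
def coeffs {R : Type*} [CommRing R] (x : Oct R) : Fin 8 → R :=
  ![x 0 + x 5 + x 6 + x 7, x 1 - x 3 + x 5 - x 6, x 2 - x 3 + x 6 - x 7, x 3 - x 5 + x 7 - x 4,
    2 * x 3, 2 * x 5, 2 * x 6, 2 * x 7]

/-- The integral vectors `2 α₀, …, 2 α₇`. -/
def doubleBasis : Fin 8 → Oct ℤ :=
  ![![2, 0, 0, 0, 0, 0, 0, 0],
    ![0, 2, 0, 0, 0, 0, 0, 0],
    ![0, 0, 2, 0, 0, 0, 0, 0],
    ![0, 0, 0, 0, -2, 0, 0, 0],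
    ![0, 1, 1, 1, 1, 0, 0, 0],
    ![-1, -1, 0, 0, -1, 1, 0, 0],
    ![-1, 1, -1, 0, 0, 0, 1, 0],
    ![-1, 0, 1, 0, 1, 0, 0, 1]]

lemma four_dvd_coeffs_mul_doubleBasis (i j k : Fin 8) :
    4 ∣ coeffs (mul (doubleBasis i) (doubleBasis j)) k := by
  revert i j k
  decide

section Map

variable {R S : Type*} [CommRing R] [CommRing S] (f : R →+* S)

lemma mul_map (x y : Oct R) : mul (f ∘ x) (f ∘ y) = f ∘ mul x y := by
  apply ext8 <;> simp [mul]

lemma coeffs_map (x : Oct R) (i : Fin 8) : coeffs (f ∘ x) i = f (coeffs x i) := by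
  fin_cases i <;> simp [coeffs, map_ofNat f 2]

end Map

lemma coeffs_smul {R : Type*} [CommRing R] (r : R) (x : Oct R) (i : Fin 8) :
    coeffs (r • x) i = r * coeffs x i := by
  fin_cases i <;> simp [coeffs] <;> ring

variable {K : Type*} [Field K]

/-- The linear combination of `α₀, …, α₇` with coefficients `c`. -/
def ofCoeffs (c : Fin 8 → K) : Oct K := ∑ i, c i • basis K i

lemma ofCoeffs_eq (c : Fin 8 → K) : ofCoeffs c =
    ![c 0 - c 5 / 2 - c 6 / 2 - c 7 / 2, c 1 + c 4 / 2 - c 5 / 2 + c 6 / 2,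
      c 2 + c 4 / 2 - c 6 / 2 + c 7 / 2, c 4 / 2, -c 3 + c 4 / 2 - c 5 / 2 + c 7 / 2,
      c 5 / 2, c 6 / 2, c 7 / 2] := by
  apply ext8 <;> simp [ofCoeffs, basis, Fin.sum_univ_eight] <;> ring

lemma basis_mem_integral (i : Fin 8) : basis K i ∈ integral K := Submodule.subset_span ⟨i, rfl⟩

lemma smul_mem_integral {r : K} (hr : r ∈ (⊥ : Subring K)) {x : Oct K} (hx : x ∈ integral K) :
    r • x ∈ integral K := by
  obtain ⟨n, rfl⟩ := mem_bot_subring.1 hr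
  rw [Int.cast_smul_eq_zsmul]
  exact Submodule.smul_mem _ _ hx

variable [CharZero K]

lemma ofCoeffs_coeffs (x : Oct K) : ofCoeffs (coeffs x) = x := by
  apply ext8 <;> simp [ofCoeffs_eq, coeffs]
  all_goals ring

lemma coeffs_ofCoeffs (c : Fin 8 → K) : coeffs (ofCoeffs c) = c := by
  apply ext8 <;> simp [ofCoeffs_eq, coeffs] <;> ring

lemma mem_integral_iff_coeffs {x : Oct K} :
    x ∈ integral K ↔ ∀ i, coeffs x i ∈ (⊥ : Subring K) := by
  refine ⟨fun hx i => ?_, fun h => ?_⟩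
  · obtain ⟨c, rfl⟩ := (Submodule.mem_span_range_iff_exists_fun ℤ).1 hx
    have : coeffs (∑ i, c i • basis K i) = fun i => (c i : K) := by
      simpa only [ofCoeffs, Int.cast_smul_eq_zsmul] using coeffs_ofCoeffs fun i => (c i : K)
    exact mem_bot_subring.2 ⟨c i, congrFun this i⟩
  · rw [← ofCoeffs_coeffs x]
    exact Submodule.sum_mem _ fun i _ => smul_mem_integral (h i) (basis_mem_integral i)

lemma basis_eq_half_doubleBasis (i : Fin 8) :
    basis K i = (1 / 2 : K) • (Int.castRingHom K ∘ doubleBasis i) := by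
  fin_cases i <;> apply ext8 <;> simp [basis, doubleBasis, neg_div]

lemma basis_mul_basis_mem_integral (i j : Fin 8) : mul (basis K i) (basis K j) ∈ integral K := by
  refine mem_integral_iff_coeffs.2 fun k => ?_
  obtain ⟨n, hn⟩ := four_dvd_coeffs_mul_doubleBasis i j k
  refine mem_bot_subring.2 ⟨n, ?_⟩
  rw [basis_eq_half_doubleBasis, basis_eq_half_doubleBasis, Oct.smul_mul, Oct.mul_smul, mul_map,
    coeffs_smul, coeffs_smul, coeffs_map, hn]
  push_cast [eq_intCast]
  ring

lemma mul_mem_integral {x y : Oct K} (hx : x ∈ integral K) (hy : y ∈ integral K) :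
    mul x y ∈ integral K := by
  have hmul (r : ℤ) (u v : Oct K) : mul (r • u) v = r • mul u v := by
    simp only [← Int.cast_smul_eq_zsmul K, Oct.smul_mul]
  have hmul' (r : ℤ) (u v : Oct K) : mul u (r • v) = r • mul u v := by
    simp only [← Int.cast_smul_eq_zsmul K, Oct.mul_smul]
  refine Submodule.span_induction₂ (p := fun u v _ _ => mul u v ∈ integral K) ?_ ?_ ?_ ?_ ?_ ?_ ?_
    hx hy
  · rintro _ _ ⟨i, rfl⟩ ⟨j, rfl⟩
    exact basis_mul_basis_mem_integral i j
  · exact fun v _ => by simp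
  · exact fun u _ => by simp
  · exact fun u v w _ _ _ hu hv => by simpa only [Oct.add_mul] using add_mem hu hv
  · exact fun u v w _ _ _ hu hv => by simpa only [Oct.mul_add] using add_mem hu hv
  · exact fun r u v _ _ h => by simpa only [hmul] using Submodule.smul_mem _ r h
  · exact fun r u v _ _ h => by simpa only [hmul'] using Submodule.smul_mem _ r h

lemma tr_mem_bot {x : Oct K} (hx : x ∈ integral K) : tr x ∈ (⊥ : Subring K) := by
  have htr : tr x = 2 * coeffs x 0 - coeffs x 5 - coeffs x 6 - coeffs x 7 := by
    simp only [tr, coeffs, Matrix.cons_val]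
    ring
  have h := mem_integral_iff_coeffs.1 hx
  rw [htr]
  exact sub_mem (sub_mem (sub_mem (mul_mem (ofNat_mem _ 2) (h 0)) (h 5)) (h 6)) (h 7)

lemma conj_mem_integral {x : Oct K} (hx : x ∈ integral K) : conj x ∈ integral K := by
  have hconj : conj x = tr x • basis K 0 - x := by
    apply ext8 <;> simp [conj_eq, tr, basis, two_mul]
  rw [hconj]
  exact sub_mem (smul_mem_integral (tr_mem_bot hx) (basis_mem_integral 0)) hx

lemma bil_mem_bot {x y : Oct K} (hx : x ∈ integral K) (hy : y ∈ integral K) :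
    bil x y ∈ (⊥ : Subring K) :=
  tr_mem_bot (mul_mem_integral hx (conj_mem_integral hy))

lemma N_basis (i : Fin 8) : N (basis K i) = 1 := by
  fin_cases i <;> simp [N_eq, basis] <;> norm_num

lemma N_mem_bot {x : Oct K} (hx : x ∈ integral K) : N x ∈ (⊥ : Subring K) := by
  induction hx using Submodule.span_induction with
  | mem x hx =>
    obtain ⟨i, rfl⟩ := hx
    simpa only [N_basis] using one_mem _
  | zero => simpa only [N_zero] using zero_mem _
  | add x y hx hy hNx hNy =>
    rw [N_add]
    exact add_mem (add_mem hNx (bil_mem_bot hx hy)) hNy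
  | smul n x _ hN =>
    rw [← Int.cast_smul_eq_zsmul K, N_smul]
    exact mul_mem (pow_mem (intCast_mem _ n) 2) hN

/-- The integral octonions are self-dual for `bil`; the coefficients below are the rows of the
inverse Gram matrix of the basis. -/
lemma exists_bil_basis_eq (n : Fin 8 → ℤ) :
    ∃ x ∈ integral K, ∀ i, bil x (basis K i) = n i := by
  let c : Fin 8 → ℤ := ![2 * n 0 + n 5 + n 6 + n 7, 2 * n 1 - n 3 - n 4 + n 5 - n 6,
    2 * n 2 - n 3 - n 4 + n 6 - n 7, -n 1 - n 2 + 2 * n 3 + n 4 - n 5 + n 7,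
    -n 1 - n 2 + n 3 + 2 * n 4, n 0 + n 1 - n 3 + 2 * n 5, n 0 - n 1 + n 2 + 2 * n 6,
    n 0 - n 2 + n 3 + 2 * n 7]
  refine ⟨ofCoeffs fun i => (c i : K), mem_integral_iff_coeffs.2 fun i => ?_, fun i => ?_⟩
  · rw [coeffs_ofCoeffs]
    exact intCast_mem _ _
  · fin_cases i <;> simp [bil_eq, ofCoeffs_eq, basis, c] <;> ring

end Oct

/-! ### Integral automorphisms of the Jordan algebra -/

namespace J

open Oct

section Automorphisms

variable {R : Type*} [CommRing R]

/-- Exchange of the first two rows and columns. -/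
def swap12 : J R ≃ₗ[R] J R :=
  LinearEquiv.ofInvolutive
    { toFun := fun X => (X.b, X.a, X.c, conj X.x, X.z, X.y)
      map_add' := fun X Y => by apply ext6 <;> simp
      map_smul' := fun r X => by apply ext6 <;> simp }
    fun X => by apply ext6 <;> simp

/-- Exchange of the last two rows and columns. -/
def swap23 : J R ≃ₗ[R] J R :=
  LinearEquiv.ofInvolutive
    { toFun := fun X => (X.a, X.c, X.b, X.y, X.x, conj X.z)
      map_add' := fun X Y => by apply ext6 <;> simp
      map_smul' := fun r X => by apply ext6 <;> simp }
    fun X => by apply ext6 <;> simp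

/-- The map underlying `J.shear`. -/
def shearLinearMap (v : Oct R) : J R →ₗ[R] J R where
  toFun X := (X.a, X.b + bil v X.x + X.a * N v, X.c, X.x + X.a • v, X.y, X.z + mul (conj v) X.y)
  map_add' X Y := by
    apply ext6 <;> simp only [a_mk, b_mk, c_mk, x_mk, y_mk, z_mk, a_add, b_add, c_add, x_add,
      y_add, z_add, bil_add_right, Oct.mul_add]
    · ring
    · module
    · module
  map_smul' r X := by
    apply ext6 <;> simp only [a_mk, b_mk, c_mk, x_mk, y_mk, z_mk, a_smul, b_smul, c_smul,
      x_smul, y_smul, z_smul, bil_smul_right, Oct.mul_smul, RingHom.id_apply]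
    · ring
    · module
    · module

lemma shearLinearMap_comp_neg (v : Oct R) :
    shearLinearMap v ∘ₗ shearLinearMap (-v) = LinearMap.id := by
  refine LinearMap.ext fun X => ?_
  apply ext6 <;> simp only [LinearMap.comp_apply, LinearMap.id_apply, shearLinearMap,
    LinearMap.coe_mk, AddHom.coe_mk, a_mk, b_mk, c_mk, x_mk, y_mk, z_mk, bil_add_right,
    bil_smul_right, ← neg_one_smul R v, bil_smul_left, bil_self, N_smul, conj_smul,
    Oct.smul_mul]
  · ring
  · module
  · module

/-- The action on Hermitian matrices of the unipotent matrix with entry `v̄` in the place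
`(2,1)`. -/
def shear (v : Oct R) : J R ≃ₗ[R] J R :=
  LinearEquiv.ofLinearMap (shearLinearMap v) (shearLinearMap (-v)) (shearLinearMap_comp_neg v)
    (by simpa only [neg_neg] using shearLinearMap_comp_neg (-v))

/-- The map contragredient to `J.shear v`. -/
def coshear (v : Oct R) : J R ≃ₗ[R] J R := (swap12.trans (shear (-conj v))).trans swap12

variable (v : Oct R) (X Y : J R)

lemma swap12_apply : swap12 X = (X.b, X.a, X.c, conj X.x, X.z, X.y) := rfl

lemma swap23_apply : swap23 X = (X.a, X.c, X.b, X.y, X.x, conj X.z) := rfl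

lemma shear_apply : shear v X =
    (X.a, X.b + bil v X.x + X.a * N v, X.c, X.x + X.a • v, X.y, X.z + mul (conj v) X.y) := rfl

lemma coshear_apply : coshear v X =
    (X.a - bil v X.x + X.b * N v, X.b, X.c, X.x - X.b • v, X.y - mul v X.z, X.z) := by
  apply ext6 <;> simp [coshear, shear_apply, swap12_apply, sub_eq_add_neg]

lemma shear_symm : (shear v).symm = shear (-v) :=
  LinearEquiv.ext fun _ => rfl

lemma coshear_symm : (coshear v).symm = coshear (-v) := by
  rw [coshear, coshear, conj_neg, ← shear_symm (-conj v)]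
  exact LinearEquiv.ext fun _ => rfl

lemma pairing_swap12 : pairing (swap12 X) (swap12 Y) = pairing X Y := by
  simp only [pairing_eq, swap12_apply, a_mk, b_mk, c_mk, x_mk, y_mk, z_mk, bil_conj_conj]
  ring

lemma pairing_swap23 : pairing (swap23 X) (swap23 Y) = pairing X Y := by
  simp only [pairing_eq, swap23_apply, a_mk, b_mk, c_mk, x_mk, y_mk, z_mk, bil_conj_conj]
  ring

lemma pairing_shear_coshear : pairing (shear v X) (coshear v Y) = pairing X Y := by
  simp only [pairing_eq, shear_apply, coshear_apply, a_mk, b_mk, c_mk, x_mk, y_mk, z_mk,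
    bil_add_left, bil_sub_right, bil_smul_left, bil_smul_right, bil_self, bil_comm _ (mul _ _),
    bil_mul]
  rw [bil_comm X.x v, tri_conj_left]
  ring

lemma sharp_swap12 : sharp (swap12 X) = swap12 (sharp X) := by
  apply ext6 <;> simp [sharp, swap12_apply, mul_comm]

lemma sharp_swap23 : sharp (swap23 X) = swap23 (sharp X) := by
  apply ext6 <;> simp [sharp, swap23_apply, mul_comm]

lemma sharp_shear : sharp (shear v X) = coshear v (sharp X) := by
  have h := mul_conj_mul_add X.x X.y v
  apply ext6 <;> simp only [sharp, shear_apply, coshear_apply, a_mk, b_mk, c_mk, x_mk, y_mk, z_mk,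
    N_add, N_mul, N_conj, N_smul, bil_smul_right, bil_sub_right, conj_add, Oct.conj_mul, conj_conj,
    conj_smul, Oct.add_mul, Oct.mul_add, Oct.mul_sub, Oct.smul_mul, Oct.mul_smul,
    mul_conj_mul_self, bil_comm _ (mul _ _), bil_mul, tri_conj_left, tri_conj_mid]
  · ring
  · rw [bil_comm X.x v]; ring
  · module
  · linear_combination (norm := module) h
  · module

lemma sharp_coshear : sharp (coshear v X) = shear v (sharp X) := by
  have hswap (Y : J R) : swap12 (swap12 Y) = Y := swap12.symm_apply_apply Y
  simp only [coshear, LinearEquiv.trans_apply, sharp_swap12, sharp_shear, conj_neg, conj_conj,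
    neg_neg, hswap]

end Automorphisms

section Integral

variable {K : Type*} [Field K] {X Y : J K}

lemma mem_integral_iff : X ∈ integral K ↔ X.a ∈ (⊥ : Subring K) ∧ X.b ∈ (⊥ : Subring K) ∧
    X.c ∈ (⊥ : Subring K) ∧ X.x ∈ Oct.integral K ∧ X.y ∈ Oct.integral K ∧
    X.z ∈ Oct.integral K := by
  simp only [mem_bot_subring]
  rfl

lemma add_mem_integral (hX : X ∈ integral K) (hY : Y ∈ integral K) : X + Y ∈ integral K := by
  obtain ⟨ha, hb, hc, hx, hy, hz⟩ := mem_integral_iff.1 hX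
  obtain ⟨ha', hb', hc', hx', hy', hz'⟩ := mem_integral_iff.1 hY
  exact mem_integral_iff.2 ⟨add_mem ha ha', add_mem hb hb', add_mem hc hc', add_mem hx hx',
    add_mem hy hy', add_mem hz hz'⟩

lemma smul_mem_integral {r : K} (hr : r ∈ (⊥ : Subring K)) (hX : X ∈ integral K) :
    r • X ∈ integral K := by
  obtain ⟨ha, hb, hc, hx, hy, hz⟩ := mem_integral_iff.1 hX
  exact mem_integral_iff.2 ⟨mul_mem hr ha, mul_mem hr hb, mul_mem hr hc,
    Oct.smul_mem_integral hr hx, Oct.smul_mem_integral hr hy, Oct.smul_mem_integral hr hz⟩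

lemma neg_mem_integral (hX : X ∈ integral K) : -X ∈ integral K := by
  simpa using smul_mem_integral (neg_mem (one_mem ⊥)) hX

lemma mem_integral_of_equiv {m : J K ≃ₗ[K] J K} (hm : ∀ X ∈ integral K, m X ∈ integral K)
    (hm_symm : ∀ X ∈ integral K, m.symm X ∈ integral K) (X : J K) :
    m X ∈ integral K ↔ X ∈ integral K :=
  ⟨fun h => m.symm_apply_apply X ▸ hm_symm _ h, hm X⟩

variable [CharZero K]

lemma sharp_mem_integral (hX : X ∈ integral K) : sharp X ∈ integral K := by
  obtain ⟨ha, hb, hc, hx, hy, hz⟩ := mem_integral_iff.1 hX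
  exact mem_integral_iff.2 ⟨sub_mem (mul_mem hb hc) (N_mem_bot hz),
    sub_mem (mul_mem ha hc) (N_mem_bot hy), sub_mem (mul_mem ha hb) (N_mem_bot hx),
    sub_mem (mul_mem_integral hy (conj_mem_integral hz)) (Oct.smul_mem_integral hc hx),
    sub_mem (mul_mem_integral hx hz) (Oct.smul_mem_integral hb hy),
    sub_mem (mul_mem_integral (conj_mem_integral hx) hy) (Oct.smul_mem_integral ha hz)⟩

lemma cross_mem_integral (hX : X ∈ integral K) (hY : Y ∈ integral K) :
    cross X Y ∈ integral K := by
  have hcross : cross X Y = sharp (X + Y) + -(sharp X + sharp Y) := by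
    rw [sharp_add]
    abel
  rw [hcross]
  exact add_mem_integral (sharp_mem_integral (add_mem_integral hX hY))
    (neg_mem_integral (add_mem_integral (sharp_mem_integral hX) (sharp_mem_integral hY)))

lemma det_mem_bot (hX : X ∈ integral K) : det X ∈ (⊥ : Subring K) := by
  obtain ⟨ha, hb, hc, hx, hy, hz⟩ := mem_integral_iff.1 hX
  exact add_mem (sub_mem (sub_mem (sub_mem (mul_mem (mul_mem ha hb) hc)
    (mul_mem ha (N_mem_bot hz))) (mul_mem hb (N_mem_bot hy))) (mul_mem hc (N_mem_bot hx)))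
    (bil_mem_bot (mul_mem_integral hx hz) hy)

lemma pairing_mem_bot (hX : X ∈ integral K) (hY : Y ∈ integral K) :
    pairing X Y ∈ (⊥ : Subring K) := by
  obtain ⟨ha, hb, hc, hx, hy, hz⟩ := mem_integral_iff.1 hX
  obtain ⟨ha', hb', hc', hx', hy', hz'⟩ := mem_integral_iff.1 hY
  exact add_mem (add_mem (add_mem (add_mem (add_mem (mul_mem ha ha') (mul_mem hb hb'))
    (mul_mem hc hc')) (bil_mem_bot hx hx')) (bil_mem_bot hy hy')) (bil_mem_bot hz hz')

lemma swap12_mem_integral (hX : X ∈ integral K) : swap12 X ∈ integral K := by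
  obtain ⟨ha, hb, hc, hx, hy, hz⟩ := hX
  exact ⟨hb, ha, hc, conj_mem_integral hx, hz, hy⟩

lemma swap23_mem_integral (hX : X ∈ integral K) : swap23 X ∈ integral K := by
  obtain ⟨ha, hb, hc, hx, hy, hz⟩ := hX
  exact ⟨ha, hc, hb, hy, hx, conj_mem_integral hz⟩

variable {v : Oct K}

lemma shear_mem_integral (hv : v ∈ Oct.integral K) (hX : X ∈ integral K) :
    shear v X ∈ integral K := by
  obtain ⟨ha, hb, hc, hx, hy, hz⟩ := mem_integral_iff.1 hX
  exact mem_integral_iff.2 ⟨ha, add_mem (add_mem hb (bil_mem_bot hv hx))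
    (mul_mem ha (N_mem_bot hv)), hc, add_mem hx (Oct.smul_mem_integral ha hv), hy,
    add_mem hz (mul_mem_integral (conj_mem_integral hv) hy)⟩

lemma coshear_mem_integral (hv : v ∈ Oct.integral K) (hX : X ∈ integral K) :
    coshear v X ∈ integral K :=
  swap12_mem_integral
    (shear_mem_integral (neg_mem (conj_mem_integral hv)) (swap12_mem_integral hX))

end Integral

/-- A contragredient pair of integral automorphisms of the cubic form `det`: the pairs which act
on the exceptional domain as the arithmetic Levi subgroup of the Siegel parabolic. -/
structure IsLeviPair {K : Type*} [Field K] (m m' : J K ≃ₗ[K] J K) : Prop where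
  pairing_map : ∀ X Y, pairing (m X) (m' Y) = pairing X Y
  sharp_map : ∀ X, sharp (m X) = m' (sharp X)
  sharp_map' : ∀ X, sharp (m' X) = m (sharp X)
  mem_integral_iff : ∀ X, m X ∈ integral K ↔ X ∈ integral K
  mem_integral_iff' : ∀ X, m' X ∈ integral K ↔ X ∈ integral K

section LeviPair

variable {K : Type*} [Field K]

namespace IsLeviPair

variable {m m' : J K ≃ₗ[K] J K}

lemma symm (h : IsLeviPair m m') : IsLeviPair m' m where
  pairing_map X Y := by rw [pairing_comm, h.pairing_map, pairing_comm]
  sharp_map := h.sharp_map'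
  sharp_map' := h.sharp_map
  mem_integral_iff := h.mem_integral_iff'
  mem_integral_iff' := h.mem_integral_iff

lemma det_map [CharZero K] (h : IsLeviPair m m') (X : J K) : det (m X) = det X := by
  have h3 : 3 * det (m X) = 3 * det X := by
    rw [← pairing_sharp_self, h.sharp_map, h.symm.pairing_map, pairing_sharp_self]
  exact mul_left_cancel₀ (by norm_num) h3

end IsLeviPair

variable [CharZero K]

lemma isLeviPair_swap12 : IsLeviPair (swap12 : J K ≃ₗ[K] J K) swap12 :=
  have hi := mem_integral_of_equiv (m := swap12 (R := K)) (fun _ => swap12_mem_integral)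
    fun _ => swap12_mem_integral
  ⟨pairing_swap12, sharp_swap12, sharp_swap12, hi, hi⟩

lemma isLeviPair_swap23 : IsLeviPair (swap23 : J K ≃ₗ[K] J K) swap23 :=
  have hi := mem_integral_of_equiv (m := swap23 (R := K)) (fun _ => swap23_mem_integral)
    fun _ => swap23_mem_integral
  ⟨pairing_swap23, sharp_swap23, sharp_swap23, hi, hi⟩

lemma isLeviPair_coshear_shear {v : Oct K} (hv : v ∈ Oct.integral K) :
    IsLeviPair (coshear v) (shear v) where
  pairing_map X Y := by rw [pairing_comm, pairing_shear_coshear, pairing_comm]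
  sharp_map := sharp_coshear v
  sharp_map' := sharp_shear v
  mem_integral_iff := mem_integral_of_equiv (fun _ => coshear_mem_integral hv) fun X hX => by
    rw [coshear_symm]
    exact coshear_mem_integral (neg_mem hv) hX
  mem_integral_iff' := mem_integral_of_equiv (fun _ => shear_mem_integral hv) fun X hX => by
    rw [shear_symm]
    exact shear_mem_integral (neg_mem hv) hX

end LeviPair

end J

/-! ### The Siegel parabolic -/

open J

/-- The linear automorphism `(X, ξ, X', ξ') ↦ (m X, ξ, m' X', ξ')`. -/
def leviEquiv (m m' : J ℂ ≃ₗ[ℂ] J ℂ) : W ≃ₗ[ℂ] W :=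
  m.prodCongr ((LinearEquiv.refl ℂ ℂ).prodCongr (m'.prodCongr (LinearEquiv.refl ℂ ℂ)))

section Levi

variable {m m' : J ℂ ≃ₗ[ℂ] J ℂ}

lemma leviEquiv_mem_Gamma (h : IsLeviPair m m') : leviEquiv m m' ∈ Gamma := by
  refine ⟨fun w => ?_, fun w v => ?_, fun w => ?_⟩
  · change pairing (sharp (m w.1)) (sharp (m' w.2.2.1)) - w.2.1 * det (m w.1)
      - w.2.2.2 * det (m' w.2.2.1) - (pairing (m w.1) (m' w.2.2.1) - w.2.1 * w.2.2.2) ^ 2 / 4 = _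
    rw [h.sharp_map, h.sharp_map', h.det_map, h.symm.det_map, h.pairing_map, h.symm.pairing_map]
    rfl
  · change pairing (m w.1) (m' v.2.2.1) - pairing (m v.1) (m' w.2.2.1) + w.2.1 * v.2.2.2
      - v.2.1 * w.2.2.2 = _
    rw [h.pairing_map, h.pairing_map]
    rfl
  · exact and_congr (h.mem_integral_iff _)
      (and_congr Iff.rfl (and_congr (h.mem_integral_iff' _) Iff.rfl))

lemma leviEquiv_toW (h : IsLeviPair m m') (Z : J ℂ) : leviEquiv m m' (toW Z) = toW (m Z) := by
  simp [leviEquiv, toW, h.sharp_map, h.det_map]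

lemma IsModularForm.comp_levi {k : ℤ} {F : J ℂ → ℂ} (hF : IsModularForm k F)
    (h : IsLeviPair m m') {Z : J ℂ} (hZ : Z ∈ domain) (hmZ : m Z ∈ domain) : F (m Z) = F Z := by
  simpa using hF.transform _ (leviEquiv_mem_Gamma h) Z hZ (m Z) hmZ 1
    (by rw [leviEquiv_toW h, one_smul])

end Levi

/-- The translation `(X, ξ, X', ξ') ↦ (X + ξ' B, ξ + (X', B) + (X, B × B) + ξ' det B,
X' + X × B + B × X + ξ' B × B, ξ')`. -/
def translateLinearMap (B : J ℂ) : W →ₗ[ℂ] W where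
  toFun w := (w.1 + w.2.2.2 • B,
    w.2.1 + pairing w.2.2.1 B + pairing w.1 (sharp B) + w.2.2.2 * det B,
    w.2.2.1 + cross w.1 B + w.2.2.2 • sharp B, w.2.2.2)
  map_add' w v := by
    refine Prod.ext ?_ (Prod.ext ?_ (Prod.ext ?_ rfl)) <;>
    simp only [Prod.fst_add, Prod.snd_add, pairing_add_left, cross_add_left]
    · module
    · ring
    · module
  map_smul' r w := by
    refine Prod.ext ?_ (Prod.ext ?_ (Prod.ext ?_ rfl)) <;>
    simp only [Prod.smul_fst, Prod.smul_snd, pairing_smul_left, cross_smul_left, smul_eq_mul,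
      RingHom.id_apply]
    · module
    · ring
    · module

lemma translateLinearMap_neg_comp (B : J ℂ) :
    translateLinearMap (-B) ∘ₗ translateLinearMap B = LinearMap.id := by
  refine LinearMap.ext fun ⟨X, ξ, X', ξ'⟩ => ?_
  refine Prod.ext ?_ (Prod.ext ?_ (Prod.ext ?_ rfl)) <;>
  simp only [LinearMap.comp_apply, LinearMap.id_apply, translateLinearMap, LinearMap.coe_mk,
    AddHom.coe_mk, pairing_neg_right, sharp_neg, det_neg, cross_neg_right, cross_add_left,
    cross_smul_left, J.cross_self, pairing_add_left, pairing_smul_left, pairing_cross_self,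
    pairing_sharp_self, pairing_comm B]
  · module
  · ring
  · module

/-- The translation by `B` as a linear automorphism. -/
def translateEquiv (B : J ℂ) : W ≃ₗ[ℂ] W :=
  LinearEquiv.ofLinearMap (translateLinearMap B) (translateLinearMap (-B))
    (by simpa only [neg_neg] using translateLinearMap_neg_comp (-B))
    (translateLinearMap_neg_comp B)

section Translate

variable (B : J ℂ)

lemma translateEquiv_apply (w : W) : translateEquiv B w = (w.1 + w.2.2.2 • B,
    w.2.1 + pairing w.2.2.1 B + pairing w.1 (sharp B) + w.2.2.2 * det B,
    w.2.2.1 + cross w.1 B + w.2.2.2 • sharp B, w.2.2.2) := rfl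

lemma translateEquiv_symm : (translateEquiv B).symm = translateEquiv (-B) :=
  LinearEquiv.ext fun _ => rfl

/-- Completing the square in the quartic form: the two expressions on the right are visibly
invariant under translations. -/
lemma sq_mul_quartic (w : W) : w.2.2.2 ^ 2 * quartic w =
    -det (w.2.2.2 • w.2.2.1 - sharp w.1)
      - (w.2.2.2 ^ 2 * w.2.1 - w.2.2.2 * pairing w.1 w.2.2.1 + 2 * det w.1) ^ 2 / 4 := by
  simp only [quartic, sub_eq_add_neg, det_add, det_smul, sharp_smul, sharp_neg, sharp_sharp,
    pairing_smul_left, pairing_smul_right, pairing_neg_right, det_neg, det_sharp,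
    pairing_comm w.2.2.1 w.1, pairing_comm (sharp w.2.2.1)]
  ring

lemma sq_mul_quartic_translate (w : W) :
    w.2.2.2 ^ 2 * quartic (translateEquiv B w) = w.2.2.2 ^ 2 * quartic w := by
  have h := sq_mul_quartic (translateEquiv B w)
  have hξ' : (translateEquiv B w).2.2.2 = w.2.2.2 := rfl
  have hcubic : w.2.2.2 • (translateEquiv B w).2.2.1 - sharp (translateEquiv B w).1
      = w.2.2.2 • w.2.2.1 - sharp w.1 := by
    simp only [translateEquiv_apply, sharp_add, sharp_smul, cross_smul_right]
    module
  have hsquare : w.2.2.2 ^ 2 * (translateEquiv B w).2.1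
        - w.2.2.2 * pairing (translateEquiv B w).1 (translateEquiv B w).2.2.1
        + 2 * det (translateEquiv B w).1
      = w.2.2.2 ^ 2 * w.2.1 - w.2.2.2 * pairing w.1 w.2.2.1 + 2 * det w.1 := by
    simp only [translateEquiv_apply, det_add, det_smul, pairing_add_left, pairing_add_right,
      pairing_smul_left, pairing_smul_right, sharp_smul, pairing_cross_left_self,
      pairing_comm B (sharp B), pairing_sharp_self, pairing_comm B (cross _ _),
      pairing_cross_self, pairing_comm B w.2.2.1]
    ring
  rw [hξ', hcubic, hsquare] at h
  rw [h, sq_mul_quartic w]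

lemma continuous_quartic : Continuous quartic := by
  unfold quartic
  simp only [pairing_eq, det_eq, sharp, Oct.bil_eq, Oct.tri, Oct.tr, Oct.N_eq, Oct.mul,
    Oct.conj_eq, Matrix.cons_val, Pi.sub_apply, Pi.smul_apply, smul_eq_mul, J.a, J.b, J.c, J.x,
    J.y, J.z]
  fun_prop

lemma quartic_translate (w : W) : quartic (translateEquiv B w) = quartic w := by
  -- The factor `ξ' ^ 2` can only be cancelled where `ξ' ≠ 0`, which is a dense set.
  have hdense : Dense {v : W | v.2.2.2 ≠ 0} :=
    (dense_compl_singleton (0 : ℂ)).preimage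
      (isOpenMap_snd.comp (isOpenMap_snd.comp isOpenMap_snd))
  have hcont : Continuous (translateEquiv B) :=
    LinearMap.continuous_of_finiteDimensional (translateEquiv B).toLinearMap
  have heq := (continuous_quartic.comp hcont).ext_on hdense continuous_quartic
    fun v hv => mul_left_cancel₀ (pow_ne_zero 2 hv) (sq_mul_quartic_translate B v)
  exact congrFun heq w

lemma symp_translate (w v : W) :
    symp (translateEquiv B w) (translateEquiv B v) = symp w v := by
  have hcross : pairing w.1 (cross v.1 B) = pairing v.1 (cross w.1 B) := by
    rw [← pairing_cross_rotate, cross_comm w.1 v.1, pairing_cross_rotate]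
  simp only [symp, translateEquiv_apply, pairing_add_left, pairing_add_right, pairing_smul_left,
    pairing_smul_right, pairing_comm B (cross _ _), pairing_cross_self, hcross,
    pairing_comm B (sharp B), pairing_sharp_self, pairing_comm B w.2.2.1, pairing_comm B v.2.2.1]
  ring

lemma translateEquiv_toW (Z : J ℂ) : translateEquiv B (toW Z) = toW (Z + B) := by
  simp only [translateEquiv_apply, toW, one_smul, one_mul, det_add, sharp_add]

variable {B}

lemma translateEquiv_mem_latticeW (hB : B ∈ J.integral ℂ) {w : W} (hw : w ∈ latticeW) :
    translateEquiv B w ∈ latticeW := by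
  obtain ⟨hX, hξ, hX', hξ'⟩ := hw
  rw [← mem_bot_subring] at hξ hξ'
  exact ⟨add_mem_integral hX (J.smul_mem_integral hξ' hB),
    mem_bot_subring.1 (add_mem (add_mem (add_mem hξ (pairing_mem_bot hX' hB))
      (pairing_mem_bot hX (sharp_mem_integral hB))) (mul_mem hξ' (det_mem_bot hB))),
    add_mem_integral (add_mem_integral hX' (cross_mem_integral hX hB))
      (J.smul_mem_integral hξ' (sharp_mem_integral hB)), mem_bot_subring.1 hξ'⟩

lemma translateEquiv_mem_Gamma (hB : B ∈ J.integral ℂ) : translateEquiv B ∈ Gamma := by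
  refine ⟨quartic_translate B, symp_translate B, fun w => ⟨fun h => ?_,
    translateEquiv_mem_latticeW hB⟩⟩
  rw [← (translateEquiv B).symm_apply_apply w, translateEquiv_symm]
  exact translateEquiv_mem_latticeW (neg_mem_integral hB) h

lemma IsModularForm.map_add {k : ℤ} {F : J ℂ → ℂ} (hF : IsModularForm k F)
    (hB : B ∈ J.integral ℂ) {Z : J ℂ} (hZ : Z ∈ domain) (hZB : Z + B ∈ domain) :
    F (Z + B) = F Z := by
  simpa using hF.transform _ (translateEquiv_mem_Gamma hB) Z hZ (Z + B) hZB 1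
    (by rw [translateEquiv_toW, one_smul])

end Translate

/-! ### Integrals of periodic functions -/

section Periodic

open MeasureTheory Set

/-- Mathlib's Fourier series on tori use the Haar probability measure, which is not syntactically
the default `volume` of `AddCircle`. -/
local instance measureSpaceUnitAddCircle : MeasureSpace UnitAddCircle := ⟨AddCircle.haarAddCircle⟩

local instance isAddHaarMeasure_unitAddCircle :
    Measure.IsAddHaarMeasure (volume : Measure UnitAddCircle) :=
  inferInstanceAs (Measure.IsAddHaarMeasure AddCircle.haarAddCircle)

/-- Functions on `ℝ^ι` which are periodic under `ℤ^ι`. -/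
def IsPeriodic {ι E : Type*} (G : (ι → ℝ) → E) : Prop :=
  ∀ (t : ι → ℝ) (n : ι → ℤ), G (t + fun i => (n i : ℝ)) = G t

section Torus

variable {ι : Type*}

/-- The projection of `ℝ^ι` onto the torus. -/
def toTorus (t : ι → ℝ) : UnitAddTorus ι := fun i => (t i : UnitAddCircle)

/-- A (discontinuous) section of the projection onto the torus. It turns a periodic function `G` on
`ℝ^ι` into the function `θ ↦ G (torusSection θ)` on the torus. -/
def torusSection (θ : UnitAddTorus ι) : ι → ℝ := fun i => (AddCircle.equivIoc 1 0 (θ i)).1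

@[simp] lemma toTorus_torusSection (θ : UnitAddTorus ι) : toTorus (torusSection θ) = θ :=
  funext fun i => (AddCircle.equivIoc 1 0).symm_apply_apply (θ i)

lemma toTorus_add (s t : ι → ℝ) : toTorus (s + t) = toTorus s + toTorus t := rfl

lemma toTorus_eq_iff {s t : ι → ℝ} :
    toTorus s = toTorus t ↔ ∃ n : ι → ℤ, s = t + fun i => (n i : ℝ) := by
  constructor
  · intro h
    have hcoord : ∀ i, ∃ n : ℤ, s i = t i + n := fun i => by
      obtain ⟨n, hn⟩ := AddSubgroup.mem_zmultiples_iff.1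
        (QuotientAddGroup.eq_iff_sub_mem.1 (congrFun h i))
      exact ⟨n, by simp only [zsmul_eq_mul, mul_one] at hn; linarith⟩
    choose n hn using hcoord
    exact ⟨n, funext hn⟩
  · rintro ⟨n, rfl⟩
    funext i
    simp [toTorus]

lemma isOpenQuotientMap_toTorus : IsOpenQuotientMap (toTorus (ι := ι)) :=
  IsOpenQuotientMap.piMap fun _ => QuotientAddGroup.isOpenQuotientMap_mk

namespace IsPeriodic

variable {E : Type*} {G : (ι → ℝ) → E}

lemma eq_of_toTorus_eq (hG : IsPeriodic G) {s t : ι → ℝ} (h : toTorus s = toTorus t) :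
    G s = G t := by
  obtain ⟨n, rfl⟩ := toTorus_eq_iff.1 h
  exact hG t n

lemma comp_torusSection_toTorus (hG : IsPeriodic G) (t : ι → ℝ) :
    G (torusSection (toTorus t)) = G t :=
  hG.eq_of_toTorus_eq (toTorus_torusSection _)

lemma continuous_comp_torusSection [TopologicalSpace E] (hG : IsPeriodic G) (hc : Continuous G) :
    Continuous fun θ => G (torusSection θ) := by
  rw [isOpenQuotientMap_toTorus.isQuotientMap.continuous_iff]
  exact hc.congr fun t => (hG.comp_torusSection_toTorus t).symm

variable [Fintype ι] [NormedAddCommGroup E] [NormedSpace ℝ E]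

lemma integral_comp_torusSection (hG : IsPeriodic G) :
    ∫ θ, G (torusSection θ) = ∫ t in Icc (0 : ι → ℝ) 1, G t := by
  have hbox : {x : ι → ℝ | ∀ i, x i ∈ Ioc ((0 : ι → ℝ) i) ((0 : ι → ℝ) i + 1)} =
      Set.pi univ fun i => Ioc ((0 : ι → ℝ) i) ((1 : ι → ℝ) i) := by
    ext x
    simp [Set.mem_pi]
  rw [UnitAddTorus.integral_preimage _ (0 : ι → ℝ), volume_pi,
    ← setIntegral_congr_set (Measure.univ_pi_Ioc_ae_eq_Icc (f := (0 : ι → ℝ)) (g := 1)), hbox]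
  exact congrArg _ (funext hG.comp_torusSection_toTorus)

lemma integral_add_right (hG : IsPeriodic G) (v : ι → ℝ) :
    ∫ t in Icc (0 : ι → ℝ) 1, G (t + v) = ∫ t in Icc (0 : ι → ℝ) 1, G t := by
  have hv : IsPeriodic fun t => G (t + v) := fun t n => by
    simpa only [add_right_comm] using hG (t + v) n
  rw [← hG.integral_comp_torusSection, ← hv.integral_comp_torusSection,
    ← integral_add_right_eq_self (fun θ => G (torusSection θ)) (toTorus v)]
  refine congrArg _ (funext fun θ => hG.eq_of_toTorus_eq ?_)
  rw [toTorus_add, toTorus_torusSection, toTorus_torusSection]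

end IsPeriodic

section LinearMap

variable {L : (ι → ℝ) →ₗ[ℝ] ι → ℝ}
  (hL : ∀ n : ι → ℤ, ∃ m : ι → ℤ, L (fun i => (n i : ℝ)) = fun i => (m i : ℝ))

include hL

lemma IsPeriodic.comp_linearMap {E : Type*} {G : (ι → ℝ) → E} (hG : IsPeriodic G) :
    IsPeriodic fun t => G (L t) := fun t n => by
  obtain ⟨m, hm⟩ := hL n
  simp only [map_add, hm, hG (L t) m]

lemma exists_continuous_addMonoidHom_toTorus [Finite ι] :
    ∃ φ : UnitAddTorus ι →+ UnitAddTorus ι, Continuous φ ∧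
      ∀ t, φ (toTorus t) = toTorus (L t) := by
  have hdesc : IsPeriodic fun t => toTorus (L t) :=
    IsPeriodic.comp_linearMap hL fun t n => toTorus_eq_iff.2 ⟨n, rfl⟩
  refine ⟨AddMonoidHom.mk' (fun θ => toTorus (L (torusSection θ))) fun θ η => ?_,
    hdesc.continuous_comp_torusSection
      (isOpenQuotientMap_toTorus.continuous.comp L.continuous_of_finiteDimensional),
    hdesc.comp_torusSection_toTorus⟩
  rw [← toTorus_add, ← map_add]
  exact hdesc.eq_of_toTorus_eq (by simp only [toTorus_add, toTorus_torusSection])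

end LinearMap

lemma IsPeriodic.integral_comp_linearMap [Fintype ι] {E : Type*} [NormedAddCommGroup E]
    [NormedSpace ℝ E] {G : (ι → ℝ) → E} (hG : IsPeriodic G) (hc : Continuous G)
    {L : (ι → ℝ) →ₗ[ℝ] ι → ℝ} (hsurj : Function.Surjective L)
    (hL : ∀ n : ι → ℤ, ∃ m : ι → ℤ, L (fun i => (n i : ℝ)) = fun i => (m i : ℝ)) :
    ∫ t in Icc (0 : ι → ℝ) 1, G (L t) = ∫ t in Icc (0 : ι → ℝ) 1, G t := by
  obtain ⟨φ, hφc, hφ⟩ := exists_continuous_addMonoidHom_toTorus hL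
  have hφsurj : Function.Surjective φ := fun θ => by
    obtain ⟨t, ht⟩ := hsurj (torusSection θ)
    exact ⟨toTorus t, by rw [hφ, ht, toTorus_torusSection]⟩
  have hmap : Measure.map φ (volume : Measure (UnitAddTorus ι)) = volume :=
    (φ.measurePreserving hφc hφsurj rfl).map_eq
  have hcov := integral_map (μ := volume) hφc.aemeasurable
    (hG.continuous_comp_torusSection hc).aestronglyMeasurable
  rw [hmap] at hcov
  rw [← hG.integral_comp_torusSection, hcov,
    ← IsPeriodic.integral_comp_torusSection (hG.comp_linearMap hL)]
  refine congrArg _ (funext fun θ => hG.eq_of_toTorus_eq ?_)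
  rw [toTorus_torusSection, ← hφ, toTorus_torusSection]

lemma mFourier_toTorus [Fintype ι] (m : ι → ℤ) (s : ι → ℝ) :
    UnitAddTorus.mFourier (-m) (toTorus s) =
      Complex.exp (-(2 * Real.pi * Complex.I * ∑ j, (m j : ℂ) * s j)) := by
  simp only [UnitAddTorus.mFourier, toTorus, ContinuousMap.coe_mk, fourier_coe_apply,
    ← Complex.exp_sum, Finset.mul_sum, ← Finset.sum_neg_distrib]
  refine congrArg _ (Finset.sum_congr rfl fun j _ => ?_)
  push_cast [Pi.neg_apply]
  ring

lemma IsPeriodic.mFourierCoeff_comp_torusSection [Fintype ι] {g : (ι → ℝ) → ℂ}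
    (hg : IsPeriodic g) (m : ι → ℤ) :
    UnitAddTorus.mFourierCoeff (fun θ => g (torusSection θ)) m =
      ∫ s in Icc (0 : ι → ℝ) 1, g s *
        Complex.exp (-(2 * Real.pi * Complex.I * ∑ j, (m j : ℂ) * s j)) := by
  let k : (ι → ℝ) → ℂ := fun s => UnitAddTorus.mFourier (-m) (toTorus s) * g s
  have hk : IsPeriodic k := fun s n => by
    simp only [k, hg s n]
    rw [toTorus_eq_iff.2 ⟨n, rfl⟩]
  calc UnitAddTorus.mFourierCoeff (fun θ => g (torusSection θ)) m
      = ∫ θ, k (torusSection θ) := by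
        simp only [UnitAddTorus.mFourierCoeff, k, toTorus_torusSection, smul_eq_mul]
    _ = _ := by
        rw [hk.integral_comp_torusSection]
        simp only [k, mFourier_toTorus, mul_comm]

end Torus

lemma integral_integral_swap_of_continuousOn {X Y E : Type*} [TopologicalSpace X]
    [MeasurableSpace X] [BorelSpace X] [T2Space X]
    [TopologicalSpace Y] [MeasurableSpace Y] [BorelSpace Y] [SecondCountableTopology Y] [T2Space Y]
    [NormedAddCommGroup E] [NormedSpace ℝ E]
    (μ : Measure X) (ν : Measure Y) [SFinite μ] [SFinite ν] [IsFiniteMeasureOnCompacts μ]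
    [IsFiniteMeasureOnCompacts ν] {s : Set X} {t : Set Y} (hs : IsCompact s) (ht : IsCompact t)
    {f : X → Y → E} (hf : ContinuousOn (Function.uncurry f) (s ×ˢ t)) :
    ∫ x in s, ∫ y in t, f x y ∂ν ∂μ = ∫ y in t, ∫ x in s, f x y ∂μ ∂ν := by
  apply integral_integral_swap
  rw [Measure.prod_restrict]
  exact hf.integrableOn_compact (hs.prod ht)

lemma IsPeriodic.integral_eq_integral_line {ι E : Type*} [Fintype ι] [NormedAddCommGroup E]
    [NormedSpace ℝ E] [CompleteSpace E] {G : (ι → ℝ) → E} (hG : IsPeriodic G) (hc : Continuous G)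
    (v : ι → ℝ) :
    ∫ t in Icc (0 : ι → ℝ) 1, G t =
      ∫ t in Icc (0 : ι → ℝ) 1, ∫ r in (0 : ℝ)..1, G (t + r • v) := by
  simp only [intervalIntegral.integral_of_le zero_le_one, ← integral_Icc_eq_integral_Ioc]
  rw [integral_integral_swap_of_continuousOn volume volume isCompact_Icc isCompact_Icc
    (by fun_prop)]
  simp only [hG.integral_add_right]
  simp

/-- The point of `ℝ^ι` with coordinates `u` and `s`, where `e` exhibits `ι` as the union of two sets
of indices. It is used to restrict a periodic function to the subtorus `s = 0`. -/
def combine {α β ι : Type*} (e : α ⊕ β ≃ ι) (u : α → ℝ) (s : β → ℝ) : ι → ℝ :=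
  Sum.elim u s ∘ e.symm

section Slice

variable {α β ι : Type*} (e : α ⊕ β ≃ ι)

@[simp] lemma combine_inl (u : α → ℝ) (s : β → ℝ) (i : α) :
    combine e u s (e (Sum.inl i)) = u i := by
  simp [combine]

@[simp] lemma combine_inr (u : α → ℝ) (s : β → ℝ) (i : β) :
    combine e u s (e (Sum.inr i)) = s i := by
  simp [combine]

lemma continuous_combine : Continuous fun p : (α → ℝ) × (β → ℝ) => combine e p.1 p.2 := by
  refine continuous_pi fun i => ?_
  obtain ⟨j | j, rfl⟩ := e.surjective i <;> simp only [combine_inl, combine_inr] <;> fun_prop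

lemma combine_add_intCast (u : α → ℝ) (s : β → ℝ) (m : α → ℤ) (n : β → ℤ) :
    combine e (u + fun i => (m i : ℝ)) (s + fun i => (n i : ℝ)) =
      combine e u s + fun i => ((Sum.elim m n (e.symm i) : ℤ) : ℝ) := by
  funext i
  obtain ⟨j | j, rfl⟩ := e.surjective i <;> simp

variable {E : Type*} {G : (ι → ℝ) → E}

lemma IsPeriodic.combine_left (hG : IsPeriodic G) (s : β → ℝ) :
    IsPeriodic fun u => G (combine e u s) := fun u n => by
  simpa [← Pi.zero_def] using (congrArg G (combine_add_intCast e u s n 0)).trans (hG _ _)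

lemma IsPeriodic.combine_right (hG : IsPeriodic G) (u : α → ℝ) :
    IsPeriodic fun s => G (combine e u s) := fun s n => by
  simpa [← Pi.zero_def] using (congrArg G (combine_add_intCast e u s 0 n)).trans (hG _ _)

lemma preimage_combine_Icc :
    (fun p : (α → ℝ) × (β → ℝ) => combine e p.1 p.2) ⁻¹' Icc 0 1 = Icc 0 1 ×ˢ Icc 0 1 := by
  have hforall : ∀ P : ι → Prop, (∀ i, P i) ↔
      (∀ a, P (e (Sum.inl a))) ∧ ∀ b, P (e (Sum.inr b)) := fun P => by
    rw [← e.forall_congr_right, Sum.forall]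
  ext p
  simp only [mem_preimage, mem_Icc, Pi.le_def, mem_prod, hforall, combine_inl, combine_inr,
    Pi.zero_apply, Pi.one_apply]
  tauto

variable [Fintype α] [Fintype β] [Fintype ι]

lemma measurePreserving_combine :
    MeasurePreserving fun p : (α → ℝ) × (β → ℝ) => combine e p.1 p.2 := by
  convert! (volume_measurePreserving_piCongrLeft (fun _ : ι => ℝ) e).comp
    (volume_measurePreserving_sumPiEquivProdPi_symm fun _ : α ⊕ β => ℝ) using 1
  funext p i
  obtain ⟨j, rfl⟩ := e.surjective i
  rw [Function.comp_apply, MeasurableEquiv.piCongrLeft_apply_apply]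
  rcases j with j | j <;> simp [MeasurableEquiv.sumPiEquivProdPi]

lemma integral_combine [NormedAddCommGroup E] [NormedSpace ℝ E] (hc : Continuous G) :
    ∫ t in Icc (0 : ι → ℝ) 1, G t =
      ∫ s in Icc (0 : β → ℝ) 1, ∫ u in Icc (0 : α → ℝ) 1, G (combine e u s) := by
  have hcc : Continuous fun p : (α → ℝ) × (β → ℝ) => G (combine e p.1 p.2) :=
    hc.comp (continuous_combine e)
  rw [← (measurePreserving_combine e).map_eq, setIntegral_map measurableSet_Icc
    hc.aestronglyMeasurable (measurePreserving_combine e).aemeasurable, preimage_combine_Icc,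
    Measure.volume_eq_prod, setIntegral_prod _
    (hcc.continuousOn.integrableOn_compact (isCompact_Icc.prod isCompact_Icc)),
    integral_integral_swap_of_continuousOn _ _ isCompact_Icc isCompact_Icc hcc.continuousOn]

/-- The Fourier series of a function on the subtorus converges at the origin, being finite. -/
lemma IsPeriodic.integral_slice {G : (ι → ℝ) → ℂ} (hG : IsPeriodic G) (hc : Continuous G)
    (h : ∀ m : β → ℤ, m ≠ 0 → ∫ t in Icc (0 : ι → ℝ) 1, G t *
      Complex.exp (-(2 * Real.pi * Complex.I * ∑ j, (m j : ℂ) * t (e (Sum.inr j)))) = 0) :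
    ∫ u in Icc (0 : α → ℝ) 1, G (combine e u 0) = ∫ t in Icc (0 : ι → ℝ) 1, G t := by
  let g : (β → ℝ) → ℂ := fun s => ∫ u in Icc (0 : α → ℝ) 1, G (combine e u s)
  have hg : IsPeriodic g := fun s n => by
    simp only [g, (hG.combine_right e _) s n]
  have hgc : Continuous g := continuous_parametric_integral_of_continuous
    (f := fun s u => G (combine e u s))
    (hc.comp ((continuous_combine e).comp continuous_swap)) isCompact_Icc
  let f : C(UnitAddTorus β, ℂ) := ⟨_, hg.continuous_comp_torusSection hgc⟩
  have hcoeff : ∀ m, UnitAddTorus.mFourierCoeff f m = ∫ t in Icc (0 : ι → ℝ) 1, G t *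
      Complex.exp (-(2 * Real.pi * Complex.I * ∑ j, (m j : ℂ) * t (e (Sum.inr j)))) := fun m => by
    refine (hg.mFourierCoeff_comp_torusSection m).trans ?_
    rw [integral_combine e (by fun_prop)]
    simp only [g, combine_inr, integral_mul_const]
  have hne : ∀ m, m ≠ 0 → UnitAddTorus.mFourierCoeff f m = 0 := fun m hm =>
    (hcoeff m).trans (h m hm)
  have hsum := UnitAddTorus.hasSum_mFourier_series_apply_of_summable (f := f)
    (summable_of_ne_finset_zero (s := {0}) fun m hm => hne m (by simpa using hm)) (toTorus 0)
  have hf0 : f (toTorus 0) = UnitAddTorus.mFourierCoeff f 0 := by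
    simpa [UnitAddTorus.mFourier_zero] using
      hsum.unique (hasSum_single 0 fun m hm => by rw [hne m hm, zero_smul])
  calc ∫ u in Icc (0 : α → ℝ) 1, G (combine e u 0) = f (toTorus 0) :=
        (hg.comp_torusSection_toTorus 0).symm
    _ = ∫ t in Icc (0 : ι → ℝ) 1, G t := by simpa [hcoeff] using hf0

end Slice

end Periodic

/-- Cauchy's theorem on a rectangle, whose vertical sides cancel by periodicity. -/
lemma integral_eq_integral_add_mul_I {E : Type*} [NormedAddCommGroup E] [NormedSpace ℂ E]
    {H : ℂ → E} {s : ℝ} (hs : 0 ≤ s)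
    (hd : DifferentiableOn ℂ H {w | 0 ≤ w.im ∧ w.im ≤ s})
    (hp : ∀ w, 0 ≤ w.im → w.im ≤ s → H (w + 1) = H w) :
    ∫ r in (0 : ℝ)..1, H r = ∫ r in (0 : ℝ)..1, H (r + s * Complex.I) := by
  have hrect := Complex.integral_boundary_rect_eq_zero_of_differentiableOn H 0 (1 + s * Complex.I)
    (hd.mono fun w hw => by simpa [Set.uIcc_of_le hs] using hw.2)
  have hside : ∫ y in (0 : ℝ)..s, H (1 + y * Complex.I) = ∫ y in (0 : ℝ)..s, H (y * Complex.I) := by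
    refine intervalIntegral.integral_congr fun y hy => ?_
    rw [Set.uIcc_of_le hs] at hy
    rw [add_comm (1 : ℂ), hp _ (by simpa using hy.1) (by simpa using hy.2)]
  exact sub_eq_zero.1 (by simpa [hside] using hrect)

/-! ### Complexification -/

namespace Oct

/-- A real octonion as a complex one. -/
def ofReal (x : Oct ℝ) : Oct ℂ := Complex.ofRealHom ∘ x

@[simp] lemma ofReal_apply (x : Oct ℝ) (i : Fin 8) : ofReal x i = (x i : ℂ) := rfl

lemma ofReal_conj (x : Oct ℝ) : ofReal (conj x) = conj (ofReal x) := by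
  apply ext8 <;> simp [conj_eq]

lemma ofReal_mul (x y : Oct ℝ) : ofReal (mul x y) = mul (ofReal x) (ofReal y) :=
  (mul_map Complex.ofRealHom x y).symm

lemma ofReal_bil (x y : Oct ℝ) : ((bil x y : ℝ) : ℂ) = bil (ofReal x) (ofReal y) := by
  simp [bil_eq]

lemma ofReal_N (x : Oct ℝ) : ((N x : ℝ) : ℂ) = N (ofReal x) := by
  simp [N]

lemma ofReal_mem_integral {x : Oct ℝ} (hx : x ∈ integral ℝ) : ofReal x ∈ integral ℂ := by
  refine mem_integral_iff_coeffs.2 fun i => mem_bot_subring.2 ?_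
  obtain ⟨n, hn⟩ := mem_bot_subring.1 (mem_integral_iff_coeffs.1 hx i)
  exact ⟨n, by rw [ofReal, coeffs_map, hn, map_intCast]⟩

lemma N_nonneg (x : Oct ℝ) : 0 ≤ N x := Finset.sum_nonneg fun _ _ => sq_nonneg _

lemma N_eq_zero_iff {x : Oct ℝ} : N x = 0 ↔ x = 0 := by
  simp [N, Finset.sum_eq_zero_iff_of_nonneg fun (i : Fin 8) _ => sq_nonneg (x i), funext_iff]

lemma N_pos {x : Oct ℝ} (h : x ≠ 0) : 0 < N x :=
  (N_nonneg x).lt_of_ne' (mt N_eq_zero_iff.1 h)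

end Oct

namespace J

open Oct

/-- A real Hermitian matrix as a complex one. -/
def ofReal (X : J ℝ) : J ℂ :=
  (X.a, X.b, X.c, Oct.ofReal X.x, Oct.ofReal X.y, Oct.ofReal X.z)

lemma toComplex_eq (X Y : J ℝ) : toComplex X Y = ofReal X + Complex.I • ofReal Y := by
  apply ext6 <;> simp only [toComplex, ofReal, a_mk, b_mk, c_mk, x_mk, y_mk, z_mk, a_add, b_add,
    c_add, x_add, y_add, z_add, a_smul, b_smul, c_smul, x_smul, y_smul, z_smul, mul_comm]
  all_goals
    funext i
    simp

lemma toComplex_zero (X : J ℝ) : toComplex X 0 = ofReal X := by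
  rw [toComplex_eq, show ofReal 0 = 0 from ?_, smul_zero, add_zero]
  apply ext6 <;> first | exact Complex.ofReal_zero | exact funext fun _ => Complex.ofReal_zero

lemma im_toComplex (X Y : J ℝ) : im (toComplex X Y) = Y := by
  apply ext6 <;> simp [toComplex, im]

lemma toComplex_mem_domain {X Y : J ℝ} (hY : Y ∈ posCone) : toComplex X Y ∈ domain := by
  change im (toComplex X Y) ∈ posCone
  rwa [im_toComplex]

lemma toComplex_add_smul (X Y V : J ℝ) (w : ℂ) :
    toComplex X Y + w • ofReal V = toComplex (X + w.re • V) (Y + w.im • V) := by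
  have entry (p q v : ℝ) : (p + q * Complex.I + w * v : ℂ) =
      ((p + w.re * v : ℝ) : ℂ) + ((q + w.im * v : ℝ) : ℂ) * Complex.I := by
    apply Complex.ext <;> simp
  apply ext6
  iterate 3 exact entry _ _ _
  all_goals exact funext fun i => entry _ _ _

lemma ofReal_mem_integral {X : J ℝ} (hX : X ∈ integral ℝ) : ofReal X ∈ integral ℂ := by
  obtain ⟨⟨l, hl⟩, ⟨m, hm⟩, ⟨n, hn⟩, hx, hy, hz⟩ := hX
  exact ⟨⟨l, by simp [ofReal, hl]⟩, ⟨m, by simp [ofReal, hm]⟩, ⟨n, by simp [ofReal, hn]⟩,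
    Oct.ofReal_mem_integral hx, Oct.ofReal_mem_integral hy, Oct.ofReal_mem_integral hz⟩

lemma ofReal_pairing (X Y : J ℝ) : ((pairing X Y : ℝ) : ℂ) = pairing (ofReal X) (ofReal Y) := by
  simp [pairing_eq, ofReal, ofReal_bil]

lemma pairing_ofReal_toComplex (T X Y : J ℝ) :
    pairing (ofReal T) (toComplex X Y) = pairing T X + pairing T Y * Complex.I := by
  rw [toComplex_eq, pairing_add_right, pairing_smul_right, ← ofReal_pairing, ← ofReal_pairing,
    mul_comm]

lemma ofReal_swap12 (X : J ℝ) : ofReal (swap12 X) = swap12 (ofReal X) := by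
  simp [ofReal, swap12_apply, ofReal_conj]

lemma ofReal_swap23 (X : J ℝ) : ofReal (swap23 X) = swap23 (ofReal X) := by
  simp [ofReal, swap23_apply, ofReal_conj]

lemma ofReal_coshear (v : Oct ℝ) (X : J ℝ) :
    ofReal (coshear v X) = coshear (Oct.ofReal v) (ofReal X) := by
  simp only [coshear_apply, ofReal]
  apply ext6 <;> simp only [a_mk, b_mk, c_mk, x_mk, y_mk, z_mk]
  · push_cast [ofReal_bil, ofReal_N]
    rfl
  · funext i
    simp
  · rw [← Oct.ofReal_mul]
    funext i
    simp

lemma map_toComplex {m : J ℝ ≃ₗ[ℝ] J ℝ} {M : J ℂ ≃ₗ[ℂ] J ℂ}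
    (h : ∀ X, ofReal (m X) = M (ofReal X)) (X Y : J ℝ) :
    M (toComplex X Y) = toComplex (m X) (m Y) := by
  rw [toComplex_eq, toComplex_eq, map_add, map_smul, h, h]

/-! ### The positive cone -/

lemma one_mem_posCone : one ℝ ∈ posCone :=
  ⟨one ℝ, by simp [det_eq, one, tri_zero_right],
    by apply ext6 <;> simp [sq, one, N_zero, Oct.mul_zero]⟩

lemma mem_posCone2 {a b : ℝ} {x : Oct ℝ} (ha : 0 < a) (hx : N x < a * b) :
    ((a, b, x) : J2 ℝ) ∈ posCone2 := by
  have hb : 0 < b := pos_of_mul_pos_right ((N_nonneg x).trans_lt hx) ha.le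
  -- By Cayley–Hamilton, `√X = (X + √(det X)) / √(tr X + 2 √(det X))` for `2 × 2` matrices.
  set d := √(a * b - N x)
  have hd : 0 < d := Real.sqrt_pos.2 (by linarith)
  have hd_sq : d ^ 2 = a * b - N x := Real.sq_sqrt (by linarith)
  set s := √(a + b + 2 * d)
  have hs : 0 < s := Real.sqrt_pos.2 (by linarith)
  have hs_sq : s ^ 2 = a + b + 2 * d := Real.sq_sqrt (by linarith)
  refine ⟨(a + d) / s, (b + d) / s, s⁻¹ • x, ?_, Prod.ext ?_ (Prod.ext ?_ ?_)⟩ <;>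
    simp only [N_smul]
  · have hdet : (a + d) / s * ((b + d) / s) - s⁻¹ ^ 2 * N x = d := by
      field_simp
      rw [hs_sq]
      linear_combination -hd_sq
    rw [hdet]
    exact hd.ne'
  · field_simp
    rw [hs_sq]
    linear_combination -hd_sq
  · field_simp
    rw [hs_sq]
    linear_combination -hd_sq
  · have : ((a + d) / s + (b + d) / s) * s⁻¹ = 1 := by
      field_simp
      rw [hs_sq]
      ring
    rw [smul_smul, this, one_smul]

lemma block_mem_posCone {a b c : ℝ} {x : Oct ℝ} (h : ((a, b, x) : J2 ℝ) ∈ posCone2) (hc : 0 < c) :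
    ((a, b, c, x, 0, 0) : J ℝ) ∈ posCone := by
  obtain ⟨p, q, u, hdet, heq⟩ := h
  simp only [Prod.mk.injEq] at heq
  obtain ⟨rfl, rfl, rfl⟩ := heq
  refine ⟨(p, q, √c, u, 0, 0), ?_, ?_⟩
  · have : det (p, q, √c, u, 0, 0) = √c * (p * q - N u) := by
      simp only [det_eq, a_mk, b_mk, c_mk, x_mk, y_mk, z_mk, N_zero, tri_zero_right]
      ring
    rw [this]
    exact mul_ne_zero (Real.sqrt_pos.2 hc).ne' hdet
  · apply ext6 <;> simp [sq, N_zero, Oct.mul_zero, Real.sq_sqrt hc.le]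

lemma sq_minor_eq {R : Type*} [CommRing R] (X : J R) : X.sq.a * X.sq.b - N X.sq.x =
    (sharp X).c ^ 2 + N (sharp X).y + N (sharp X).z := by
  simp only [sq, sharp, a_mk, b_mk, c_mk, x_mk, y_mk, z_mk, N_add, N_sub, N_smul, N_mul, N_conj,
    bil_smul_left, bil_smul_right, bil_mul, bil_comm X.x, tri_conj_left, tri_conj_mid]
  ring

lemma posCone_minor_pos {T : J ℝ} (hT : T ∈ posCone) : N T.x < T.a * T.b := by
  obtain ⟨X, hX, rfl⟩ := hT
  rw [← sub_pos, sq_minor_eq]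
  have hy := N_nonneg (sharp X).y
  have hz := N_nonneg (sharp X).z
  have hc := sq_nonneg (sharp X).c
  refine lt_of_le_of_ne (by positivity) fun h => hX ?_
  have hc0 : (sharp X).c = 0 := by nlinarith
  have hy0 : (sharp X).y = 0 := N_eq_zero_iff.1 (by linarith)
  have hz0 : (sharp X).z = 0 := N_eq_zero_iff.1 (by linarith)
  have hdet : det (sharp X) = 0 := by
    rw [det_eq, hc0, hy0, hz0]
    simp [N_zero, tri_zero_right]
  rwa [det_sharp, sq_eq_zero_iff] at hdet

lemma sq_swap12 (X : J ℝ) : sq (swap12 X) = swap12 (sq X) := by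
  apply ext6 <;> simp [sq, swap12_apply, N_conj, add_comm, add_assoc, add_left_comm]

lemma sq_swap23 (X : J ℝ) : sq (swap23 X) = swap23 (sq X) := by
  apply ext6 <;> simp [sq, swap23_apply, N_conj, add_comm, add_assoc, add_left_comm]

lemma swap12_mem_posCone {T : J ℝ} (hT : T ∈ posCone) : swap12 T ∈ posCone := by
  obtain ⟨X, hX, rfl⟩ := hT
  exact ⟨swap12 X, by rwa [isLeviPair_swap12.det_map], (sq_swap12 X).symm⟩

lemma swap23_mem_posCone {T : J ℝ} (hT : T ∈ posCone) : swap23 T ∈ posCone := by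
  obtain ⟨X, hX, rfl⟩ := hT
  exact ⟨swap23 X, by rwa [isLeviPair_swap23.det_map], (sq_swap23 X).symm⟩

end J

/-! ### Coordinates -/

/-- The index set of the coordinates on the `27`-dimensional space `𝔍(ℝ)`. -/
abbrev Idx := Fin 3 ⊕ Fin 3 × Fin 8

namespace J

open Oct

/-- The coordinates with respect to the basis of `𝔍(ℤ)`. -/
def coords (X : J ℝ) : Idx → ℝ :=
  Sum.elim ![X.a, X.b, X.c] fun p => ![coeffs X.x, coeffs X.y, coeffs X.z] p.1 p.2

lemma ofCoords_coords (X : J ℝ) : ofCoords (coords X) = X := by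
  apply ext6
  iterate 3 rfl
  exacts [ofCoeffs_coeffs X.x, ofCoeffs_coeffs X.y, ofCoeffs_coeffs X.z]

lemma coords_ofCoords (t : Idx → ℝ) : coords (ofCoords t) = t := by
  funext p
  rcases p with i | ⟨i, j⟩
  · fin_cases i <;> rfl
  · have hcoeffs (c : Fin 8 → ℝ) : coeffs (∑ i, c i • basis ℝ i) = c := coeffs_ofCoeffs c
    fin_cases i <;> simp [coords, ofCoords, hcoeffs]

/-- `ofCoords` as a linear equivalence. -/
def ofCoordsEquiv : (Idx → ℝ) ≃ₗ[ℝ] J ℝ where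
  toFun := ofCoords
  invFun := coords
  left_inv := coords_ofCoords
  right_inv := ofCoords_coords
  map_add' s t := by
    apply ext6 <;> simp [ofCoords, add_smul, Finset.sum_add_distrib]
  map_smul' r t := by
    apply ext6 <;> simp [ofCoords, Finset.smul_sum, smul_smul]

lemma mem_integral_iff_coords {X : J ℝ} :
    X ∈ integral ℝ ↔ ∀ p, coords X p ∈ (⊥ : Subring ℝ) := by
  simp [mem_integral_iff, mem_integral_iff_coeffs, coords, Fin.forall_fin_succ, and_assoc]

lemma ofCoords_intCast_mem_integral (n : Idx → ℤ) : ofCoords (fun p => (n p : ℝ)) ∈ integral ℝ :=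
  mem_integral_iff_coords.2 fun p => mem_bot_subring.2 ⟨n p, by rw [coords_ofCoords]⟩

lemma exists_coords_eq_intCast {X : J ℝ} (hX : X ∈ integral ℝ) :
    ∃ n : Idx → ℤ, coords X = fun p => (n p : ℝ) := by
  choose n hn using fun p => mem_bot_subring.1 (mem_integral_iff_coords.1 hX p)
  exact ⟨n, funext hn⟩

end J

/-! ### Fourier coefficients -/

section Fourier

open MeasureTheory Set

/-- The function `F(Z) e^{-2πi (T, Z)}` whose mean over the translates of `𝔍(ℝ)` is the Fourier
coefficient of `F` at `T`. -/
def twist (F : J ℂ → ℂ) (T : J ℝ) (Z : J ℂ) : ℂ :=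
  F Z * Complex.exp (-(2 * Real.pi * Complex.I * pairing (ofReal T) Z))

/-- The Fourier coefficient of `F` at `T` computed on the translate `𝔍(ℝ) + iY`. -/
def fourierCoeffAt (F : J ℂ → ℂ) (T Y : J ℝ) : ℂ :=
  ∫ t in Icc (0 : Idx → ℝ) 1, twist F T (toComplex (ofCoords t) Y)

lemma fourierCoeff_eq (F : J ℂ → ℂ) (T : J ℝ) :
    fourierCoeff F T = fourierCoeffAt F T (one ℝ) := by
  simp only [fourierCoeff, fourierCoeffAt, twist, toComplex_zero]

lemma J.continuous_ofCoords : Continuous ofCoords :=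
  LinearMap.continuous_of_finiteDimensional ofCoordsEquiv.toLinearMap

lemma J.ofCoords_add (s t : Idx → ℝ) : ofCoords (s + t) = ofCoords s + ofCoords t :=
  map_add ofCoordsEquiv s t

lemma J.ofCoords_smul (r : ℝ) (t : Idx → ℝ) : ofCoords (r • t) = r • ofCoords t :=
  map_smul ofCoordsEquiv r t

lemma J.continuous_toComplex (Y : J ℝ) : Continuous fun X => toComplex X Y := by
  unfold toComplex J.a J.b J.c J.x J.y J.z
  fun_prop

lemma J.differentiable_pairing (T : J ℂ) : Differentiable ℂ (pairing T) :=
  (LinearMap.toContinuousLinearMap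
    { toFun := pairing T
      map_add' := pairing_add_right T
      map_smul' := fun r Z => pairing_smul_right T Z r } : J ℂ →L[ℂ] ℂ).differentiable

namespace IsModularForm

variable {k : ℤ} {F : J ℂ → ℂ} (hF : IsModularForm k F) {T Y : J ℝ}

include hF

lemma differentiableOn_twist (T : J ℝ) : DifferentiableOn ℂ (twist F T) domain :=
  hF.holo.mul (((differentiable_pairing _).const_mul _).neg.cexp.differentiableOn)

lemma twist_add (hT : T ∈ J.integral ℝ) {B : J ℝ} (hB : B ∈ J.integral ℝ) {Z : J ℂ}
    (hZ : Z ∈ domain) (hZB : Z + ofReal B ∈ domain) : twist F T (Z + ofReal B) = twist F T Z := by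
  obtain ⟨n, hn⟩ := mem_bot_subring.1 (pairing_mem_bot hT hB)
  have hexp : -(2 * Real.pi * Complex.I * pairing (ofReal T) (Z + ofReal B)) =
      -(2 * Real.pi * Complex.I * pairing (ofReal T) Z) + (-n : ℤ) * (2 * Real.pi * Complex.I) := by
    rw [pairing_add_right, ← ofReal_pairing, hn]
    push_cast
    ring
  rw [twist, hF.map_add (ofReal_mem_integral hB) hZ hZB, hexp, Complex.exp_add,
    Complex.exp_int_mul_two_pi_mul_I, mul_one, twist]

lemma continuous_twist (T : J ℝ) (hY : Y ∈ posCone) :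
    Continuous fun t => twist F T (toComplex (ofCoords t) Y) :=
  (hF.differentiableOn_twist T).continuousOn.comp_continuous
    ((continuous_toComplex Y).comp continuous_ofCoords) fun _ => toComplex_mem_domain hY

lemma isPeriodic_twist (hT : T ∈ J.integral ℝ) (hY : Y ∈ posCone) :
    IsPeriodic fun t => twist F T (toComplex (ofCoords t) Y) := fun t n => by
  have hshift := toComplex_add_smul (ofCoords t) Y (ofCoords fun p => (n p : ℝ)) 1
  simp only [one_smul, Complex.one_re, Complex.one_im, zero_smul, add_zero, ← ofCoords_add]
    at hshift
  simp only [← hshift]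
  exact hF.twist_add hT (ofCoords_intCast_mem_integral n) (toComplex_mem_domain hY)
    (hshift ▸ toComplex_mem_domain hY)

lemma integral_twist_line_eq (hT : T ∈ J.integral ℝ) {V : J ℝ} (hV : V ∈ J.integral ℝ) {s : ℝ}
    (hs : 0 ≤ s) (hY : ∀ r, 0 ≤ r → r ≤ s → Y + r • V ∈ posCone) (X : J ℝ) :
    ∫ r in (0 : ℝ)..1, twist F T (toComplex (X + r • V) Y) =
      ∫ r in (0 : ℝ)..1, twist F T (toComplex (X + r • V) (Y + s • V)) := by
  let line (w : ℂ) : J ℂ := toComplex X Y + w • ofReal V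
  have line_mem (w : ℂ) (h0 : 0 ≤ w.im) (h1 : w.im ≤ s) : line w ∈ domain := by
    simp only [line, toComplex_add_smul]
    exact toComplex_mem_domain (hY _ h0 h1)
  have hdiff : DifferentiableOn ℂ (fun w => twist F T (line w)) {w | 0 ≤ w.im ∧ w.im ≤ s} :=
    (hF.differentiableOn_twist T).comp (by fun_prop) fun w hw => line_mem w hw.1 hw.2
  have hper (w : ℂ) (h0 : 0 ≤ w.im) (h1 : w.im ≤ s) :
      twist F T (line (w + 1)) = twist F T (line w) := by
    have hline : line (w + 1) = line w + ofReal V := by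
      simp only [line]
      module
    rw [hline]
    exact hF.twist_add hT hV (line_mem w h0 h1)
      (hline ▸ line_mem (w + 1) (by simpa using h0) (by simpa using h1))
  have hshift := integral_eq_integral_add_mul_I hs hdiff hper
  simpa [line, toComplex_add_smul] using hshift

lemma fourierCoeffAt_add_smul (hT : T ∈ J.integral ℝ) {V : J ℝ} (hV : V ∈ J.integral ℝ) {s : ℝ}
    (hs : 0 ≤ s) (hY : ∀ r, 0 ≤ r → r ≤ s → Y + r • V ∈ posCone) :
    fourierCoeffAt F T (Y + s • V) = fourierCoeffAt F T Y := by
  have h0 : Y ∈ posCone := by simpa using hY 0 le_rfl hs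
  have h1 : Y + s • V ∈ posCone := hY s hs le_rfl
  rw [fourierCoeffAt, fourierCoeffAt,
    (hF.isPeriodic_twist hT h0).integral_eq_integral_line (hF.continuous_twist T h0) (coords V),
    (hF.isPeriodic_twist hT h1).integral_eq_integral_line (hF.continuous_twist T h1) (coords V)]
  simp only [ofCoords_add, ofCoords_smul, ofCoords_coords]
  exact integral_congr_ae (.of_forall fun t =>
    (hF.integral_twist_line_eq hT hV hs hY (ofCoords t)).symm)

lemma fourierCoeffAt_map {m m' : J ℝ ≃ₗ[ℝ] J ℝ} {M M' : J ℂ ≃ₗ[ℂ] J ℂ} (h : IsLeviPair m m')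
    (H : IsLeviPair M M') (hM : ∀ X, ofReal (m X) = M (ofReal X)) (hT : T ∈ J.integral ℝ)
    (hY : Y ∈ posCone) (hmY : m Y ∈ posCone) :
    fourierCoeffAt F (m' T) (m Y) = fourierCoeffAt F T Y := by
  let L := ofCoordsEquiv.trans (m.trans ofCoordsEquiv.symm)
  have ofCoords_L (t : Idx → ℝ) : ofCoords (L t) = m (ofCoords t) := ofCoords_coords _
  have hL (n : Idx → ℤ) : ∃ n' : Idx → ℤ, L (fun p => (n p : ℝ)) = fun p => (n' p : ℝ) :=
    exists_coords_eq_intCast ((h.mem_integral_iff _).2 (ofCoords_intCast_mem_integral n))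
  rw [fourierCoeffAt, ← (hF.isPeriodic_twist ((h.mem_integral_iff' T).2 hT)
    hmY).integral_comp_linearMap (L := L.toLinearMap) (hF.continuous_twist _ hmY) L.surjective hL]
  refine integral_congr_ae (.of_forall fun t => ?_)
  have hFM : F (toComplex (m (ofCoords t)) (m Y)) = F (toComplex (ofCoords t) Y) := by
    rw [← map_toComplex hM]
    exact hF.comp_levi H (toComplex_mem_domain hY)
      (map_toComplex hM (ofCoords t) Y ▸ toComplex_mem_domain hmY)
  simp only [LinearEquiv.coe_coe, ofCoords_L, twist, hFM, pairing_ofReal_toComplex,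
    h.symm.pairing_map]

lemma fourierCoeff_swap12 (hT : T ∈ J.integral ℝ) :
    fourierCoeff F (swap12 T) = fourierCoeff F T := by
  have hone : swap12 (one ℝ) = one ℝ := by simp [swap12_apply, one]
  have hmap := hF.fourierCoeffAt_map isLeviPair_swap12 isLeviPair_swap12 ofReal_swap12 hT
    one_mem_posCone (swap12_mem_posCone one_mem_posCone)
  rwa [hone, ← fourierCoeff_eq, ← fourierCoeff_eq] at hmap

lemma fourierCoeff_swap23 (hT : T ∈ J.integral ℝ) :
    fourierCoeff F (swap23 T) = fourierCoeff F T := by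
  have hone : swap23 (one ℝ) = one ℝ := by simp [swap23_apply, one]
  have hmap := hF.fourierCoeffAt_map isLeviPair_swap23 isLeviPair_swap23 ofReal_swap23 hT
    one_mem_posCone (swap23_mem_posCone one_mem_posCone)
  rwa [hone, ← fourierCoeff_eq, ← fourierCoeff_eq] at hmap

end IsModularForm

lemma J.coshear_one (v : Oct ℝ) : coshear v (one ℝ) = (1 + v.N, 1, 1, -v, 0, 0) := by
  simp [coshear_apply, one, Oct.bil_zero_right, Oct.mul_zero]

lemma J.coshear_one_path_mem_posCone (v : Oct ℝ) {r : ℝ} (h0 : 0 ≤ r) (h1 : r ≤ 1) :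
    ((1 + v.N, 1, 1, r • -v, 0, 0) : J ℝ) ∈ posCone := by
  have hN := v.N_nonneg
  refine block_mem_posCone (mem_posCone2 (by positivity) ?_) one_pos
  rw [Oct.N_smul, Oct.N_neg]
  nlinarith [mul_le_mul_of_nonneg_right (pow_le_one₀ h0 h1 : r ^ 2 ≤ 1) hN]

lemma J.coshear_one_mem_posCone (v : Oct ℝ) : coshear v (one ℝ) ∈ posCone := by
  simpa only [coshear_one, one_smul] using coshear_one_path_mem_posCone v zero_le_one le_rfl

namespace IsModularForm

variable {k : ℤ} {F : J ℂ → ℂ} (hF : IsModularForm k F) {T : J ℝ}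

include hF

lemma fourierCoeffAt_coshear_one {v : Oct ℝ} (hv : v ∈ Oct.integral ℝ) (hT : T ∈ J.integral ℝ) :
    fourierCoeffAt F T (coshear v (one ℝ)) = fourierCoeffAt F T (one ℝ) := by
  have hdiag (r : ℝ) : one ℝ + r • ((1, 0, 0, 0, 0, 0) : J ℝ) = (1 + r, 1, 1, 0, 0, 0) := by
    simp [one]
  have hoff (r : ℝ) : ((1 + v.N, 1, 1, 0, 0, 0) : J ℝ) + r • (0, 0, 0, -v, 0, 0) =
      (1 + v.N, 1, 1, r • -v, 0, 0) := by
    simp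
  have hdiag_mem : ((1, 0, 0, 0, 0, 0) : J ℝ) ∈ J.integral ℝ :=
    mem_integral_iff.2 ⟨one_mem _, zero_mem _, zero_mem _, zero_mem _, zero_mem _, zero_mem _⟩
  have hoff_mem : ((0, 0, 0, -v, 0, 0) : J ℝ) ∈ J.integral ℝ :=
    mem_integral_iff.2 ⟨zero_mem _, zero_mem _, zero_mem _, neg_mem hv, zero_mem _, zero_mem _⟩
  calc fourierCoeffAt F T (coshear v (one ℝ))
      = fourierCoeffAt F T ((1 + v.N, 1, 1, 0, 0, 0) + (1 : ℝ) • (0, 0, 0, -v, 0, 0)) := by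
        rw [coshear_one, hoff, one_smul]
    _ = fourierCoeffAt F T (1 + v.N, 1, 1, 0, 0, 0) :=
        hF.fourierCoeffAt_add_smul hT hoff_mem zero_le_one fun r h0 h1 => by
          rw [hoff]
          exact coshear_one_path_mem_posCone v h0 h1
    _ = fourierCoeffAt F T (one ℝ + v.N • (1, 0, 0, 0, 0, 0)) := by rw [hdiag]
    _ = fourierCoeffAt F T (one ℝ) :=
        hF.fourierCoeffAt_add_smul hT hdiag_mem v.N_nonneg fun r h0 _ => by
          rw [hdiag]
          refine block_mem_posCone (mem_posCone2 (by positivity) ?_) one_pos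
          rw [Oct.N_zero]
          positivity

lemma fourierCoeff_shear {v : Oct ℝ} (hv : v ∈ Oct.integral ℝ) (hT : T ∈ J.integral ℝ) :
    fourierCoeff F (shear v T) = fourierCoeff F T := by
  rw [fourierCoeff_eq, fourierCoeff_eq,
    ← hF.fourierCoeffAt_coshear_one hv (shear_mem_integral hv hT)]
  exact hF.fourierCoeffAt_map (isLeviPair_coshear_shear hv)
    (isLeviPair_coshear_shear (Oct.ofReal_mem_integral hv)) (ofReal_coshear v) hT one_mem_posCone
    (coshear_one_mem_posCone v)

lemma exists_norm_fourierCoeff_le : ∃ C : ℝ, ∀ T : J ℝ,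
    ‖fourierCoeff F T‖ ≤ C * Real.exp (2 * Real.pi * (T.a + T.b + T.c)) := by
  obtain ⟨C, hC⟩ := isCompact_Icc.exists_bound_of_continuousOn (s := Icc (0 : Idx → ℝ) 1)
    (hF.holo.continuousOn.comp_continuous ((continuous_toComplex (one ℝ)).comp continuous_ofCoords)
      fun _ => toComplex_mem_domain one_mem_posCone).continuousOn
  refine ⟨C, fun T => ?_⟩
  have hpairing : pairing T (one ℝ) = T.a + T.b + T.c := by simp [pairing_eq, one]
  have hbound : ∀ t ∈ Icc (0 : Idx → ℝ) 1, ‖twist F T (toComplex (ofCoords t) (one ℝ))‖ ≤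
      C * Real.exp (2 * Real.pi * (T.a + T.b + T.c)) := fun t ht => by
    rw [twist, norm_mul, Complex.norm_exp]
    refine mul_le_mul (hC t ht) (le_of_eq ?_) (Real.exp_pos _).le ((norm_nonneg _).trans (hC t ht))
    simp [pairing_ofReal_toComplex, hpairing]
  simpa [fourierCoeff_eq, fourierCoeffAt, Real.volume_Icc_pi, measureReal_def] using
    norm_setIntegral_le_of_norm_le_const (μ := volume) isCompact_Icc.measure_lt_top hbound

end IsModularForm

end Fourier

/-! ### Vanishing of Fourier coefficients -/

namespace IsModularForm

variable {k : ℤ} {F : J ℂ → ℂ} (hF : IsModularForm k F) {T : J ℝ}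

include hF

lemma fourierCoeff_eq_zero_of_shear_b_le (hT : T ∈ J.integral ℝ)
    (h : ∀ B : ℝ, ∃ v ∈ Oct.integral ℝ, (shear v T).b ≤ B) : fourierCoeff F T = 0 := by
  obtain ⟨C, hC⟩ := hF.exists_norm_fourierCoeff_le
  have hle (B : ℝ) : ‖fourierCoeff F T‖ ≤ |C| * Real.exp B := by
    obtain ⟨v, hv, hB⟩ := h (B / (2 * Real.pi) - T.a - T.c)
    have htrace : (shear v T).a + (shear v T).b + (shear v T).c ≤ B / (2 * Real.pi) := by
      simp only [shear_apply, a_mk, b_mk, c_mk] at hB ⊢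
      linarith
    calc ‖fourierCoeff F T‖ = ‖fourierCoeff F (shear v T)‖ := by rw [hF.fourierCoeff_shear hv hT]
      _ ≤ C * Real.exp (2 * Real.pi * _) := hC _
      _ ≤ |C| * Real.exp B := by
        gcongr
        · exact le_abs_self C
        · rwa [mul_comm, ← le_div_iff₀ Real.two_pi_pos]
  have hlim : Filter.Tendsto (fun B => |C| * Real.exp B) Filter.atBot (nhds 0) := by
    simpa using Real.tendsto_exp_atBot.const_mul |C|
  exact norm_le_zero_iff.1 (ge_of_tendsto' hlim hle)

lemma fourierCoeff_eq_zero_of_a_neg (hT : T ∈ J.integral ℝ) (ha : T.a < 0) :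
    fourierCoeff F T = 0 := by
  refine hF.fourierCoeff_eq_zero_of_shear_b_le hT fun B => ?_
  obtain ⟨n, hn⟩ := exists_nat_ge (max 1 ((2 * T.x 0 + |T.b - B|) / -T.a))
  have hn1 : (1 : ℝ) ≤ n := (le_max_left _ _).trans hn
  have hnT : 2 * T.x 0 + |T.b - B| ≤ n * -T.a :=
    (div_le_iff₀ (neg_pos.2 ha)).1 ((le_max_right _ _).trans hn)
  refine ⟨(n : ℝ) • Oct.basis ℝ 0,
    Oct.smul_mem_integral (natCast_mem _ n) (Oct.basis_mem_integral 0), ?_⟩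
  have hbil : Oct.bil (Oct.basis ℝ 0) T.x = 2 * T.x 0 := by simp [Oct.bil_eq, Oct.basis]
  simp only [shear_apply, b_mk, Oct.bil_smul_left, Oct.N_smul, hbil, Oct.N_basis]
  nlinarith [le_abs_self (T.b - B), abs_nonneg (T.b - B)]

lemma fourierCoeff_eq_zero_of_a_eq_zero (hT : T ∈ J.integral ℝ) (ha : T.a = 0) (hx : T.x ≠ 0) :
    fourierCoeff F T = 0 := by
  refine hF.fourierCoeff_eq_zero_of_shear_b_le hT fun B => ?_
  have hN := Oct.N_pos hx
  obtain ⟨n, hn⟩ := exists_nat_ge ((T.b - B) / (2 * Oct.N T.x))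
  rw [div_le_iff₀ (by positivity)] at hn
  refine ⟨(-n : ℝ) • T.x,
    Oct.smul_mem_integral (neg_mem (natCast_mem _ n)) (mem_integral_iff.1 hT).2.2.2.1, ?_⟩
  simp only [shear_apply, b_mk, Oct.bil_smul_left, Oct.bil_self, ha]
  linarith

lemma fourierCoeff_eq_zero_of_b_neg (hT : T ∈ J.integral ℝ) (hb : T.b < 0) :
    fourierCoeff F T = 0 := by
  rw [← hF.fourierCoeff_swap12 hT]
  exact hF.fourierCoeff_eq_zero_of_a_neg (swap12_mem_integral hT) (by simpa [swap12_apply])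

lemma fourierCoeff_eq_zero_of_b_eq_zero (hT : T ∈ J.integral ℝ) (hb : T.b = 0) (hz : T.z ≠ 0) :
    fourierCoeff F T = 0 := by
  have hT12 := swap12_mem_integral hT
  rw [← hF.fourierCoeff_swap12 hT, ← hF.fourierCoeff_swap23 hT12]
  exact hF.fourierCoeff_eq_zero_of_a_eq_zero (swap23_mem_integral hT12)
    (by simpa [swap12_apply, swap23_apply]) (by simpa [swap12_apply, swap23_apply])

lemma fourierCoeff_eq_zero_of_c_eq_zero (hT : T ∈ J.integral ℝ) (hc : T.c = 0)
    (hyz : T.y ≠ 0 ∨ T.z ≠ 0) : fourierCoeff F T = 0 := by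
  have hT23 := swap23_mem_integral hT
  have conj_ne_zero {x : Oct ℝ} (hx : x ≠ 0) : Oct.conj x ≠ 0 := fun h =>
    hx (by rw [← Oct.conj_conj x, h, Oct.conj_zero])
  rw [← hF.fourierCoeff_swap23 hT]
  rcases hyz with hy | hz
  · rw [← hF.fourierCoeff_swap12 hT23]
    exact hF.fourierCoeff_eq_zero_of_a_eq_zero (swap12_mem_integral hT23)
      (by simpa [swap12_apply, swap23_apply])
      (by simpa [swap12_apply, swap23_apply] using conj_ne_zero hy)
  · exact hF.fourierCoeff_eq_zero_of_b_eq_zero hT23 (by simpa [swap23_apply])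
      (by simpa [swap23_apply] using conj_ne_zero hz)

end IsModularForm

/-! ### Integrals over slices of `𝔍(ℝ) / 𝔍(ℤ)` -/

lemma J.exists_pairing_ofCoords_eq (n : Idx → ℤ) :
    ∃ D ∈ J.integral ℝ, ∀ t, pairing D (ofCoords t) = ∑ p, n p * t p := by
  choose d hd hdn using fun i => Oct.exists_bil_basis_eq (K := ℝ) fun j => n (Sum.inr (i, j))
  refine ⟨(n (Sum.inl 0), n (Sum.inl 1), n (Sum.inl 2), d 0, d 1, d 2),
    ⟨⟨_, rfl⟩, ⟨_, rfl⟩, ⟨_, rfl⟩, hd 0, hd 1, hd 2⟩, fun t => ?_⟩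
  have hbil (i : Fin 3) : Oct.bil (d i) (∑ j, t (Sum.inr (i, j)) • Oct.basis ℝ j) =
      ∑ j, n (Sum.inr (i, j)) * t (Sum.inr (i, j)) := by
    simp only [Fin.sum_univ_eight, Oct.bil_add_right, Oct.bil_smul_right, hdn, mul_comm]
  simp only [pairing_eq, ofCoords, a_mk, b_mk, c_mk, x_mk, y_mk, z_mk, hbil,
    Fintype.sum_sum_type, Fintype.sum_prod_type, Fin.sum_univ_three]
  ring

lemma twist_add_left (F : J ℂ → ℂ) (T D : J ℝ) (Z : J ℂ) : twist F (T + D) Z =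
    twist F T Z * Complex.exp (-(2 * Real.pi * Complex.I * pairing (ofReal D) Z)) := by
  have hadd : ofReal (T + D) = ofReal T + ofReal D := by
    apply ext6 <;>
      first | exact Complex.ofReal_add _ _ | exact funext fun _ => Complex.ofReal_add _ _
  simp only [twist, hadd, pairing_add_left, mul_assoc, ← Complex.exp_add]
  ring_nf

lemma IsModularForm.integral_twist_combine {k : ℤ} {F : J ℂ → ℂ} (hF : IsModularForm k F)
    {T : J ℝ} (hT : T ∈ J.integral ℝ) {α β : Type*} [Fintype α] [Finite β] (e : α ⊕ β ≃ Idx)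
    (h : ∀ D ∈ J.integral ℝ, D ≠ 0 → (∀ u, pairing D (ofCoords (combine e u 0)) = 0) →
      fourierCoeff F (T + D) = 0) :
    ∫ u in Set.Icc (0 : α → ℝ) 1, twist F T (toComplex (ofCoords (combine e u 0)) (one ℝ)) =
      fourierCoeff F T := by
  cases nonempty_fintype β
  rw [fourierCoeff_eq, fourierCoeffAt]
  refine (hF.isPeriodic_twist hT one_mem_posCone).integral_slice e
    (hF.continuous_twist T one_mem_posCone) fun m hm => ?_
  obtain ⟨D, hD, hpair⟩ := exists_pairing_ofCoords_eq (Sum.elim 0 m ∘ e.symm)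
  have hpair' (t : Idx → ℝ) : pairing D (ofCoords t) = ∑ j, m j * t (e (Sum.inr j)) := by
    simp [hpair, ← e.sum_comp]
  have hD0 : D ≠ 0 := by
    rintro rfl
    have hsum : ∑ j, (m j : ℝ) * m j = 0 := by
      simpa [pairing_eq, Oct.bil_zero_left] using (hpair' (combine e 0 fun j => m j)).symm
    exact hm (funext fun j => by simpa using (Finset.sum_mul_self_eq_zero_iff _ _).1 hsum j)
  have hcoeff := h D hD hD0 fun u => by simp [hpair']
  have htwist (t : Idx → ℝ) : twist F T (toComplex (ofCoords t) (one ℝ)) *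
      Complex.exp (-(2 * Real.pi * Complex.I * ∑ j, (m j : ℂ) * t (e (Sum.inr j)))) =
      twist F (T + D) (toComplex (ofCoords t) (one ℝ)) *
        Complex.exp (2 * Real.pi * Complex.I * (pairing D (one ℝ) * Complex.I)) := by
    rw [twist_add_left, mul_assoc (twist F T _), ← Complex.exp_add,
      pairing_ofReal_toComplex, hpair']
    push_cast
    ring_nf
  rw [fourierCoeff_eq, fourierCoeffAt] at hcoeff
  simp only [htwist, MeasureTheory.integral_mul_const, hcoeff, zero_mul]

/-! ### Cusp forms -/

lemma block_mem_domain {Z : J2 ℂ} (hZ : Z ∈ domain2) {τ : ℂ} (hτ : 0 < τ.im) :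
    block Z τ ∈ domain :=
  block_mem_posCone hZ hτ

lemma block_add (Z : J2 ℂ) (τ σ : ℂ) :
    block Z (τ + σ) = block Z τ + ((0, 0, σ, 0, 0, 0) : J ℂ) := by
  simp [block]

namespace IsCuspForm

variable {k : ℤ} {F : J ℂ → ℂ} (hF : IsCuspForm k F)

include hF

lemma map_block_add_one {Z : J2 ℂ} (hZ : Z ∈ domain2) {τ : ℂ} (hτ : 0 < τ.im) :
    F (block Z (τ + 1)) = F (block Z τ) := by
  have hint : ((0, 0, 1, 0, 0, 0) : J ℂ) ∈ J.integral ℂ :=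
    mem_integral_iff.2 ⟨zero_mem _, zero_mem _, one_mem _, zero_mem _, zero_mem _, zero_mem _⟩
  rw [block_add]
  exact hF.map_add hint (block_mem_domain hZ hτ)
    (block_add Z τ 1 ▸ block_mem_domain hZ (by simpa using hτ))

lemma integral_block_add_mul_I {Z : J2 ℂ} (hZ : Z ∈ domain2) {w : ℂ} (hw : 0 < w.im) {s : ℝ}
    (hs : 0 ≤ s) : ∫ r in (0 : ℝ)..1, F (block Z (w + (r + s * Complex.I))) =
      ∫ r in (0 : ℝ)..1, F (block Z (w + r)) := by
  have hpos (τ : ℂ) (hτ : 0 ≤ τ.im) : 0 < (w + τ).im := by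
    rw [Complex.add_im]
    linarith
  have hdiff : Differentiable ℂ fun τ : ℂ => block Z (w + τ) := by
    unfold block
    fun_prop
  refine (integral_eq_integral_add_mul_I (H := fun τ => F (block Z (w + τ))) hs
    (hF.holo.comp hdiff.differentiableOn fun τ hτ => block_mem_domain hZ (hpos τ hτ.1))
    fun τ hτ _ => ?_).symm
  rw [← add_assoc, hF.map_block_add_one hZ (hpos τ hτ)]

lemma integral_block_eq_zero {Z : J2 ℂ} (hZ : Z ∈ domain2) {w : ℂ} (hw : 0 < w.im) :
    ∫ r in (0 : ℝ)..1, F (block Z (w + r)) = 0 := by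
  refine norm_le_zero_iff.1 (le_of_forall_pos_le_add fun ε hε => ?_)
  have hsmall := Metric.tendsto_nhds.1 (hF.cusp Z hZ) ε hε
  rw [Filter.eventually_comap, Filter.eventually_atTop] at hsmall
  obtain ⟨B, hB⟩ := hsmall
  rw [← hF.integral_block_add_mul_I hZ hw (le_max_left 0 (B - w.im)), zero_add]
  have hle (r : ℝ) : ‖F (block Z (w + (r + (max 0 (B - w.im) : ℝ) * Complex.I)))‖ ≤ ε := by
    rw [← dist_zero_right]
    refine (hB (w.im + max 0 (B - w.im)) ?_ _ (by simp)).le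
    linarith [le_max_right 0 (B - w.im)]
  simpa using intervalIntegral.norm_integral_le_of_norm_le_const (a := 0) (b := 1) fun r _ => hle r

lemma integral_twist_block_eq_zero {T : J ℝ} (hc : T.c = 0) {Z : J2 ℂ} (hZ : Z ∈ domain2) {w : ℂ}
    (hw : 0 < w.im) : ∫ r in (0 : ℝ)..1, twist F T (block Z (w + r)) = 0 := by
  have hpairing (τ : ℂ) : pairing (ofReal T) (block Z τ) = pairing (ofReal T) (block Z 0) := by
    simp [pairing_eq, block, ofReal, hc]
  simp only [twist, hpairing, intervalIntegral.integral_mul_const,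
    hF.integral_block_eq_zero hZ hw, zero_mul]

end IsCuspForm

/-- The indices of the coordinates of the diagonal and of the upper left block, followed by those of
the last column, which vanish on block diagonal matrices. -/
def blockIndex : (Fin 3 ⊕ Fin 8) ⊕ (Fin 2 × Fin 8) → Idx
  | Sum.inl (Sum.inl i) => Sum.inl i
  | Sum.inl (Sum.inr j) => Sum.inr (0, j)
  | Sum.inr (i, j) => Sum.inr (i.succ, j)

lemma blockIndex_bijective : Function.Bijective blockIndex := by
  rw [Fintype.bijective_iff_injective_and_card]
  refine ⟨?_, by simp⟩
  rintro ((i | j) | ⟨i, j⟩) ((i' | j') | ⟨i', j'⟩) h <;>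
    simp_all [blockIndex, (Fin.succ_ne_zero _).symm]

/-- `blockIndex` as an equivalence. -/
def blockEquiv : (Fin 3 ⊕ Fin 8) ⊕ (Fin 2 × Fin 8) ≃ Idx :=
  .ofBijective blockIndex blockIndex_bijective

lemma ofCoords_combine_blockEquiv (u : Fin 3 ⊕ Fin 8 → ℝ) :
    ofCoords (combine blockEquiv u 0) = (u (Sum.inl 0), u (Sum.inl 1), u (Sum.inl 2),
      Oct.ofCoeffs (u ∘ Sum.inr), 0, 0) := by
  have hdiag (i : Fin 3) : combine blockEquiv u 0 (Sum.inl i) = u (Sum.inl i) :=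
    combine_inl blockEquiv u 0 (Sum.inl i)
  have hx (j : Fin 8) : combine blockEquiv u 0 (Sum.inr (0, j)) = u (Sum.inr j) :=
    combine_inl blockEquiv u 0 (Sum.inr j)
  have hy (j : Fin 8) : combine blockEquiv u 0 (Sum.inr (1, j)) = 0 :=
    combine_inr blockEquiv u 0 (0, j)
  have hz (j : Fin 8) : combine blockEquiv u 0 (Sum.inr (2, j)) = 0 :=
    combine_inr blockEquiv u 0 (1, j)
  simp [ofCoords, Oct.ofCoeffs, hdiag, hx, hy, hz]

lemma toComplex_block_one (a b c : ℝ) (x : Oct ℝ) : toComplex (a, b, c, x, 0, 0) (one ℝ) =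
    block (a + Complex.I, b + Complex.I, Oct.ofReal x) (c + Complex.I) := by
  apply ext6 <;> first
    | simp [toComplex, block, one]; done
    | funext i; simp [toComplex, block, one]

lemma mem_domain2 (a b : ℝ) (x : Oct ℝ) :
    ((a + Complex.I, b + Complex.I, Oct.ofReal x) : J2 ℂ) ∈ domain2 := by
  have := mem_posCone2 (a := 1) (b := 1) (x := 0) one_pos (by simp [Oct.N_zero])
  simpa [domain2, ← Pi.zero_def] using this

lemma eq_zero_of_pairing_block_eq_zero {D : J ℝ}
    (h : ∀ u, pairing D (ofCoords (combine blockEquiv u 0)) = 0) :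
    D.a = 0 ∧ D.b = 0 ∧ D.c = 0 ∧ D.x = 0 := by
  have hpair (a b c : ℝ) (x : Oct ℝ) : pairing D (a, b, c, x, 0, 0) = 0 := by
    have := h (Sum.elim ![a, b, c] (Oct.coeffs x))
    simpa [ofCoords_combine_blockEquiv, Oct.ofCoeffs_coeffs] using this
  simp only [pairing_eq, a_mk, b_mk, c_mk, x_mk, y_mk, z_mk, Oct.bil_zero_right, add_zero] at hpair
  refine ⟨?_, ?_, ?_, Oct.N_eq_zero_iff.1 ?_⟩
  · simpa [Oct.bil_zero_right] using hpair 1 0 0 0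
  · simpa [Oct.bil_zero_right] using hpair 0 1 0 0
  · simpa [Oct.bil_zero_right] using hpair 0 0 1 0
  · simpa [Oct.bil_self] using hpair 0 0 0 D.x

namespace IsCuspForm

variable {k : ℤ} {F : J ℂ → ℂ} (hF : IsCuspForm k F) {T : J ℝ}

include hF

lemma fourierCoeff_eq_zero_of_block (hT : T ∈ J.integral ℝ) (hc : T.c = 0) (hy : T.y = 0)
    (hz : T.z = 0) : fourierCoeff F T = 0 := by
  rw [← hF.integral_twist_combine hT blockEquiv fun D hD hD0 hpair => ?_]
  · have hper := (hF.isPeriodic_twist hT one_mem_posCone).combine_left blockEquiv 0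
    have hcont : Continuous fun u =>
        twist F T (toComplex (ofCoords (combine blockEquiv u 0)) (one ℝ)) :=
      (hF.continuous_twist T one_mem_posCone).comp
        ((continuous_combine blockEquiv).comp (.prodMk_left 0))
    rw [hper.integral_eq_integral_line hcont (Pi.single (Sum.inl 2) 1)]
    refine MeasureTheory.integral_eq_zero_of_ae (.of_forall fun u => ?_)
    have hint := hF.integral_twist_block_eq_zero hc (w := u (Sum.inl 2) + Complex.I)
      (mem_domain2 (u (Sum.inl 0)) (u (Sum.inl 1)) (Oct.ofCoeffs (u ∘ Sum.inr))) (by simp)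
    simpa [ofCoords_combine_blockEquiv, toComplex_block_one, add_right_comm, Function.comp_def]
      using hint
  · obtain ⟨ha', hb', hc', hx'⟩ := eq_zero_of_pairing_block_eq_zero hpair
    refine hF.fourierCoeff_eq_zero_of_c_eq_zero (add_mem_integral hT hD) (by simp [hc, hc']) ?_
    contrapose! hD0
    exact ext6 ha' hb' hc' hx' (by simpa [hy] using hD0.1) (by simpa [hz] using hD0.2)

/-- The shear by `-x` completes the square: it replaces `b` by `b - N(x)` and `x` by `0`. -/
lemma fourierCoeff_eq_zero_of_b_le_N (hT : T ∈ J.integral ℝ) (ha : T.a = 1)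
    (hb : T.b ≤ Oct.N T.x) : fourierCoeff F T = 0 := by
  have hx : -T.x ∈ Oct.integral ℝ := neg_mem (mem_integral_iff.1 hT).2.2.2.1
  set U := shear (-T.x) T with hU_def
  have hU : U ∈ J.integral ℝ := shear_mem_integral hx hT
  have hUb : U.b = T.b - Oct.N T.x := by
    simp only [hU_def, shear_apply, b_mk, Oct.bil_neg_left, Oct.bil_self, Oct.N_neg, ha]
    ring
  have hUx : U.x = 0 := by simp [hU_def, shear_apply, ha]
  rw [← hF.fourierCoeff_shear hx hT]
  rcases hb.lt_or_eq with hlt | heq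
  · exact hF.fourierCoeff_eq_zero_of_b_neg hU (by linarith)
  have hUb0 : U.b = 0 := by linarith
  by_cases hz : U.z = 0
  · rw [← hF.fourierCoeff_swap23 hU]
    exact hF.fourierCoeff_eq_zero_of_block (swap23_mem_integral hU) (by simpa [swap23_apply])
      (by simpa [swap23_apply]) (by simp [swap23_apply, hz, Oct.conj_zero])
  · exact hF.fourierCoeff_eq_zero_of_b_eq_zero hU hUb0 hz

end IsCuspForm

/-! ### Restriction to the Siegel upper half space -/

/-- The indices of the coordinates of the real symmetric matrices, in the order of `siegelPoint`,
followed by the other ones. -/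
def siegelIndex : Fin 6 ⊕ (Fin 3 × Fin 7) → Idx
  | Sum.inl i =>
    ![Sum.inl 0, Sum.inl 1, Sum.inl 2, Sum.inr (0, 0), Sum.inr (1, 0), Sum.inr (2, 0)] i
  | Sum.inr (i, j) => Sum.inr (i, j.succ)

lemma siegelIndex_bijective : Function.Bijective siegelIndex := by
  rw [Fintype.bijective_iff_injective_and_card]
  refine ⟨?_, by simp⟩
  rintro (i | ⟨i, j⟩) (i' | ⟨i', j'⟩) h
  · fin_cases i <;> fin_cases i' <;> simp_all [siegelIndex]
  · fin_cases i <;> simp_all [siegelIndex, (Fin.succ_ne_zero _).symm]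
  · fin_cases i' <;> simp_all [siegelIndex, Fin.succ_ne_zero]
  · simp_all [siegelIndex]

/-- `siegelIndex` as an equivalence. -/
def siegelEquiv : Fin 6 ⊕ (Fin 3 × Fin 7) ≃ Idx := .ofBijective siegelIndex siegelIndex_bijective

lemma ofCoords_combine_siegelEquiv (t : Fin 6 → ℝ) : ofCoords (combine siegelEquiv t 0) =
    (t 0, t 1, t 2, Oct.scalar (t 3), Oct.scalar (t 4), Oct.scalar (t 5)) := by
  have h0 : combine siegelEquiv t 0 (Sum.inl 0) = t 0 := combine_inl siegelEquiv t 0 0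
  have h1 : combine siegelEquiv t 0 (Sum.inl 1) = t 1 := combine_inl siegelEquiv t 0 1
  have h2 : combine siegelEquiv t 0 (Sum.inl 2) = t 2 := combine_inl siegelEquiv t 0 2
  have h3 : combine siegelEquiv t 0 (Sum.inr (0, 0)) = t 3 := combine_inl siegelEquiv t 0 3
  have h4 : combine siegelEquiv t 0 (Sum.inr (1, 0)) = t 4 := combine_inl siegelEquiv t 0 4
  have h5 : combine siegelEquiv t 0 (Sum.inr (2, 0)) = t 5 := combine_inl siegelEquiv t 0 5
  have hrest (i : Fin 3) (j : Fin 7) : combine siegelEquiv t 0 (Sum.inr (i, j.succ)) = 0 :=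
    combine_inr siegelEquiv t 0 (i, j)
  have hscalar (r : ℝ) : r • Oct.basis ℝ 0 = Oct.scalar r := by
    apply Oct.ext8 <;> simp [Oct.basis, Oct.scalar]
  simp [ofCoords, Fin.sum_univ_succ (n := 7), h0, h1, h2, h3, h4, h5, hrest, hscalar]

lemma siegelEmbed_siegelPoint (t : Fin 6 → ℝ) : siegelEmbed (siegelPoint t) =
    toComplex (ofCoords (combine siegelEquiv t 0)) (one ℝ) := by
  rw [ofCoords_combine_siegelEquiv]
  apply ext6 <;> first
    | simp [siegelEmbed, siegelPoint, toComplex, one]; done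
    | apply Oct.ext8 <;> simp [siegelEmbed, siegelPoint, toComplex, one, Oct.scalar]

lemma pairing_ofReal_siegelEmbed (T : J ℝ) {Z : Matrix (Fin 3) (Fin 3) ℂ} (hZ : Z.IsSymm) :
    pairing (ofReal T) (siegelEmbed Z) = (T.symPart.map Complex.ofReal * Z).trace := by
  simp only [ofReal, siegelEmbed, pairing_eq, a_mk, b_mk, c_mk, x_mk, y_mk, z_mk, Oct.bil_eq,
    Oct.ofReal_apply, Oct.scalar, ↓reduceIte, one_ne_zero, mul_zero, add_zero, Fin.isValue,
    Fin.reduceEq, symPart, Matrix.trace_fin_three, Matrix.mul_apply, Matrix.map_apply,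
    Matrix.of_apply, Matrix.cons_val', Matrix.cons_val_fin_one, Matrix.cons_val_zero,
    Matrix.cons_val_one, Matrix.cons_val, Fin.sum_univ_three, hZ.apply 0 1, hZ.apply 0 2,
    hZ.apply 1 2]
  ring

lemma siegelPoint_isSymm (t : Fin 6 → ℝ) : (siegelPoint t).IsSymm :=
  Matrix.IsSymm.ext fun i j => by fin_cases i <;> fin_cases j <;> rfl

lemma siegelFourierCoeff_restrict (F : J ℂ → ℂ) (T : J ℝ) :
    siegelFourierCoeff (restrict F) T.symPart = ∫ t in Set.Icc (0 : Fin 6 → ℝ) 1,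
      twist F T (toComplex (ofCoords (combine siegelEquiv t 0)) (one ℝ)) := by
  simp only [siegelFourierCoeff, restrict, twist, ← siegelEmbed_siegelPoint,
    pairing_ofReal_siegelEmbed T (siegelPoint_isSymm _)]

lemma J.symPart_add (T D : J ℝ) : (T + D).symPart = T.symPart + D.symPart := by
  simp [symPart]

lemma symPart_eq_zero_of_pairing_eq_zero {D : J ℝ}
    (h : ∀ t, pairing D (ofCoords (combine siegelEquiv t 0)) = 0) : D.symPart = 0 := by
  have hsingle : ∀ i : Fin 6, pairing D (ofCoords (combine siegelEquiv (Pi.single i 1) 0)) = 0 :=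
    fun i => h (Pi.single i 1)
  obtain ⟨ha, hb, hc, hx, hy, hz⟩ :
      D.a = 0 ∧ D.b = 0 ∧ D.c = 0 ∧ D.x 0 = 0 ∧ D.y 0 = 0 ∧ D.z 0 = 0 := by
    simpa [ofCoords_combine_siegelEquiv, pairing_eq, Oct.bil_eq, Oct.scalar,
      Fin.forall_fin_succ] using hsingle
  simp [symPart, ha, hb, hc, hx, hy, hz, ← Matrix.ext_iff, Fin.forall_fin_succ]

lemma IsModularForm.siegelFourierCoeff_restrict_eq {k : ℤ} {F : J ℂ → ℂ}
    (hF : IsModularForm k F) {T : J ℝ} (hT : T ∈ J.integral ℝ)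
    (h : ∀ T' ∈ J.integral ℝ, T' ≠ T → T'.symPart = T.symPart → fourierCoeff F T' = 0) :
    siegelFourierCoeff (restrict F) T.symPart = fourierCoeff F T := by
  rw [siegelFourierCoeff_restrict]
  exact hF.integral_twist_combine hT siegelEquiv fun D hD hD0 hpair =>
    h (T + D) (add_mem_integral hT hD) (by simpa using hD0)
      (by rw [symPart_add, symPart_eq_zero_of_pairing_eq_zero hpair, add_zero])

lemma Oct.exists_mem_integral_apply_zero (n : ℤ) : ∃ x ∈ Oct.integral ℝ, x 0 = (n : ℝ) / 2 := by
  obtain ⟨x, hx, hbil⟩ := Oct.exists_bil_basis_eq (K := ℝ) (Pi.single 0 n)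
  have hbil0 : x 0 * 2 = n := by simpa [Oct.bil_eq, Oct.basis, mul_comm] using hbil 0
  exact ⟨x, hx, by linarith⟩

lemma J.exists_mem_integral_symPart_eq {S : Matrix (Fin 3) (Fin 3) ℝ} (hS : S.IsSymm)
    (hdiag : ∀ i, ∃ n : ℤ, S i i = n) (hhalf : ∀ i j, ∃ n : ℤ, S i j = (n : ℝ) / 2) :
    ∃ T ∈ J.integral ℝ, T.symPart = S := by
  have hoct (i j : Fin 3) : ∃ x ∈ Oct.integral ℝ, x 0 = S i j := by
    obtain ⟨n, hn⟩ := hhalf i j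
    exact hn ▸ Oct.exists_mem_integral_apply_zero n
  obtain ⟨x, hx, hx0⟩ := hoct 0 1
  obtain ⟨y, hy, hy0⟩ := hoct 0 2
  obtain ⟨z, hz, hz0⟩ := hoct 1 2
  refine ⟨(S 0 0, S 1 1, S 2 2, x, y, z), ⟨hdiag 0, hdiag 1, hdiag 2, hx, hy, hz⟩, ?_⟩
  simp [symPart, hx0, hy0, hz0, ← Matrix.ext_iff, Fin.forall_fin_succ, hS.apply 0 1, hS.apply 0 2,
    hS.apply 1 2]

/-! ### The closed cone -/

lemma Oct.one_le_N {x : Oct ℝ} (hx : x ∈ Oct.integral ℝ) (hx0 : x ≠ 0) : 1 ≤ Oct.N x := by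
  obtain ⟨n, hn⟩ := mem_bot_subring.1 (Oct.N_mem_bot hx)
  have hpos := Oct.N_pos hx0
  rw [hn] at hpos ⊢
  exact_mod_cast Int.cast_pos.1 hpos

lemma Oct.isBounded_setOf_N_le (M : ℝ) : Bornology.IsBounded {x : Oct ℝ | Oct.N x ≤ M} := by
  refine isBounded_iff_forall_norm_le.2 ⟨√M, fun x hx => ?_⟩
  refine (pi_norm_le_iff_of_nonneg (Real.sqrt_nonneg M)).2 fun i => Real.abs_le_sqrt ?_
  exact (Finset.single_le_sum (f := fun i => x i ^ 2) (fun i _ => sq_nonneg (x i))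
    (Finset.mem_univ i)).trans hx

namespace J

lemma N_x_le_of_mem_closure {T : J ℝ} (hT : T ∈ closure posCone) : Oct.N T.x ≤ T.a * T.b := by
  have hclosed : IsClosed {T : J ℝ | Oct.N T.x ≤ T.a * T.b} := by
    unfold J.a J.b J.x Oct.N
    exact isClosed_le (by fun_prop) (by fun_prop)
  exact closure_minimal (fun T h => (posCone_minor_pos h).le) hclosed hT

lemma swap12_mem_closure {T : J ℝ} (hT : T ∈ closure posCone) : swap12 T ∈ closure posCone :=
  map_mem_closure (LinearMap.continuous_of_finiteDimensional (swap12 (R := ℝ)).toLinearMap) hT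
    fun _ => swap12_mem_posCone

lemma swap23_mem_closure {T : J ℝ} (hT : T ∈ closure posCone) : swap23 T ∈ closure posCone :=
  map_mem_closure (LinearMap.continuous_of_finiteDimensional (swap23 (R := ℝ)).toLinearMap) hT
    fun _ => swap23_mem_posCone

lemma N_y_le_of_mem_closure {T : J ℝ} (hT : T ∈ closure posCone) : Oct.N T.y ≤ T.a * T.c := by
  simpa [swap23_apply] using N_x_le_of_mem_closure (swap23_mem_closure hT)

lemma N_z_le_of_mem_closure {T : J ℝ} (hT : T ∈ closure posCone) : Oct.N T.z ≤ T.b * T.c := by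
  simpa [swap12_apply] using N_y_le_of_mem_closure (swap12_mem_closure hT)

lemma finite_inter_integral {s : Set (J ℝ)} (hs : Bornology.IsBounded s) :
    (s ∩ integral ℝ).Finite := by
  let basis : Module.Basis Idx ℝ (J ℝ) := .ofEquivFun ofCoordsEquiv.symm
  refine (ZSpan.setFinite_inter basis hs).subset (Set.inter_subset_inter_right s fun X hX => ?_)
  obtain ⟨n, hn⟩ := exists_coords_eq_intCast hX
  refine (basis.mem_span_iff_repr_mem ℤ X).2 fun p => ⟨n p, ?_⟩
  exact (congrFun hn p).symm

lemma finite_setOf_symPart_eq (S : Matrix (Fin 3) (Fin 3) ℝ) :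
    {T : J ℝ | T ∈ integralNonneg ∧ T.symPart = S}.Finite := by
  have hbounded : Bornology.IsBounded (({S 0 0} ×ˢ {S 1 1} ×ˢ {S 2 2} ×ˢ
      {x | Oct.N x ≤ S 0 0 * S 1 1} ×ˢ {y | Oct.N y ≤ S 0 0 * S 2 2} ×ˢ
      {z | Oct.N z ≤ S 1 1 * S 2 2} : Set (J ℝ))) :=
    Bornology.isBounded_singleton.prod <| Bornology.isBounded_singleton.prod <|
      Bornology.isBounded_singleton.prod <| (Oct.isBounded_setOf_N_le _).prod <|
        (Oct.isBounded_setOf_N_le _).prod (Oct.isBounded_setOf_N_le _)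
  refine (finite_inter_integral hbounded).subset ?_
  rintro T ⟨⟨hT, hcl⟩, rfl⟩
  exact ⟨⟨rfl, rfl, rfl, N_x_le_of_mem_closure hcl, N_y_le_of_mem_closure hcl,
    N_z_le_of_mem_closure hcl⟩, hT⟩

end J

end ExcDomain

end

open ExcDomain in
theorem mainTheorem10_general (S : Matrix (Fin 3) (Fin 3) ℝ) (a b c : ℝ)
    (hS : S = !![1, 1 / 2, a; 1 / 2, 1, b; a, b, c]) (hdiag : ∀ i, ∃ n : ℤ, S i i = n)
    (hhalf : ∀ i j, ∃ n : ℤ, S i j = (n : ℝ) / 2) :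
    (¬ ∃ T ∈ J.integralPos, T.symPart = S) ∧
    {T : J ℝ | T ∈ J.integralNonneg ∧ T.symPart = S}.Finite ∧
    ∀ (k : ℤ) (F : J ℂ → ℂ), IsCuspForm k F →
      restrictedCoeff F S = 0 ∧ siegelFourierCoeff (restrict F) S = 0 := by
  have minor_nonpos (T : J ℝ) (hT : T ∈ J.integral ℝ) (hTS : T.symPart = S) :
      T.a = 1 ∧ T.b = 1 ∧ T.b ≤ Oct.N T.x := by
    obtain ⟨ha, hb, hx⟩ : T.a = 1 ∧ T.b = 1 ∧ T.x 0 = 1 / 2 := by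
      simp_all [J.symPart]
    exact ⟨ha, hb, hb ▸ Oct.one_le_N hT.2.2.2.1 fun h => by norm_num [h] at hx⟩
  refine ⟨?_, J.finite_setOf_symPart_eq S, fun k F hF => ?_⟩
  · rintro ⟨T, ⟨hT, hpos⟩, hTS⟩
    obtain ⟨ha, -, hN⟩ := minor_nonpos T hT hTS
    simpa [ha] using hN.trans_lt (J.posCone_minor_pos hpos)
  have hzero (T : J ℝ) (hT : T ∈ J.integral ℝ) (hTS : T.symPart = S) : fourierCoeff F T = 0 :=
    have ⟨ha, _, hN⟩ := minor_nonpos T hT hTS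
    hF.fourierCoeff_eq_zero_of_b_le_N hT ha hN
  refine ⟨finsum_mem_eq_zero_of_forall_eq_zero fun T hT => hzero T hT.1.1 hT.2, ?_⟩
  have hS_symm : S.IsSymm := by simp [hS, Matrix.IsSymm, ← Matrix.ext_iff, Fin.forall_fin_succ]
  obtain ⟨T, hT, hTS⟩ := J.exists_mem_integral_symPart_eq hS_symm hdiag hhalf
  rw [← hTS, hF.siegelFourierCoeff_restrict_eq hT fun T' hT' _ h => hzero T' hT' (h.trans hTS),
    hzero T hT hTS]

theorem mainTheorem10 (S : Matrix (Fin 3) (Fin 3) ℝ) (a b c : ℝ)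
    (hS : S = !![1, 1 / 2, a; 1 / 2, 1, b; a, b, c])
    (hS_mem : S ∈ ExcDomain.halfIntegralNonneg) :
    (¬ ∃ T ∈ ExcDomain.J.integralPos, T.symPart = S) ∧
    {T : ExcDomain.J ℝ | T ∈ ExcDomain.J.integralNonneg ∧ T.symPart = S}.Finite ∧
    ∀ (k : ℤ) (F : ExcDomain.J ℂ → ℂ), ExcDomain.IsCuspForm k F →
      ExcDomain.restrictedCoeff F S = 0 ∧
      ExcDomain.siegelFourierCoeff (ExcDomain.restrict F) S = 0 :=
  mainTheorem10_general S a b c hS hS_mem.2.1 hS_mem.2.2
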